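/- Let $\beta>0$, $0<\nu\le 1$, $t>0$, and let $\lambda_1,\lambda_2,\dots\ge 0$ be pairwise distinct. A *fractional nonlinear birth process* of order $\nu$ with rates $\lambda_k$ is a counting process $\mathfrak N^\nu(s)\in\{1,2,\dots\}$, $s\ge 0$ (finite-valued, i.e. without explosion, with non-decreasing right-continuous paths), whose state probabilities $p_n(s)=\mathbb P(\mathfrak N^\nu(s)=n)$ are locally absolutely continuous and satisfy $$\frac{d^\nu p_n}{ds^\nu}=-\lambda_n p_n+\lambda_{n-1}p_{n-1}\quad(n\ge1,\ \text{a.e. } s>0),\qquad p_0\equiv 0,\quad p_n(0)=\delta_{n,1},$$ where $\frac{d^\nu f}{ds^\nu}(s)=\frac1{\Gamma(1-\nu)}\int_0^s\frac{f'(u)}{(s-u)^\nu}\,du$ is the Caputo derivative for $\nu<1$, and the ordinary derivative for $\nu=1$. Generalized Yule model: webpages appear according to a homogeneous Yule process of rate $\beta$, started from one webpage at time $0$ (the time spent with $j$ webpages is exponential with rate $\beta j$, independently for different $j$). From its creation on, the number of in-links of each webpage evolves as a fractional nonlinear birth process of order $\nu$ with rates $\lambda_k$ (so it starts with one in-link);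 these processes are independent of each other and of the process of webpages. Let ${}_t\mathfrak N^\nu$ be the number of in-links, at time $t$, of a webpage chosen uniformly at random (independently of everything else) among those created in $(0,t]$, given that at least one has been created. Let $\gamma(a,x)=\int_0^x e^{-u}u^{a-1}du$ and $\Gamma(a,x)=\int_x^\infty e^{-u}u^{a-1}du$; empty products are $1$. Then: 1. For every $n\ge 1$, the series below converge absolutely and $$\mathbb P({}_t\mathfrak N^\nu=n)=\frac{1}{1-e^{-\beta t}}\prod_{h=1}^{n-1}\lambda_h\sum_{m=1}^n\frac{1}{\prod_{l=1,\,l\ne m}^n(\lambda_l-\lambda_m)}\sum_{r=0}^\infty\frac{\gamma(\nu r+1,\beta t)}{\Gamma(\nu r+1)}\left(-\frac{\lambda_m}{\beta^\nu}\right)^r .$$ 2. For every $n\ge1$ such that $\lambda_m<\beta^\nu$ for $1\le m\le n$, the series below converge absolutely and $$\mathbb P({}_t\mathfrak N^\nu=n)=\frac{1}{1-e^{-\beta t}}\prod_{h=1}^{n-1}\lambda_h\sum_{m=1}^n\frac{1}{\prod_{l=1,\,l\ne m}^n(\lambda_l-\lambda_m)}\left[\frac{\beta^\nu}{\beta^\nu+\lambda_m}-\sum_{r=0}^\infty\frac{\Gamma(\nu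 r+1,\beta t)}{\Gamma(\nu r+1)}\left(-\frac{\lambda_m}{\beta^\nu}\right)^r\right].$$ 3. The power series $\sum_{r\ge0}\frac{\Gamma(\nu r+1,\beta t)}{\Gamma(\nu r+1)}z^r$ converges for $|z|<1$ and its sum extends to a holomorphic function $G$ on $\mathbb C\setminus\{1\}$; without any restriction on the sizes of the rates, for every $n\ge 1$, $$\mathbb P({}_t\mathfrak N^\nu=n)=\frac{1}{1-e^{-\beta t}}\prod_{h=1}^{n-1}\lambda_h\sum_{m=1}^n\frac{1}{\prod_{l=1,\,l\ne m}^n(\lambda_l-\lambda_m)}\left[\frac{\beta^\nu}{\beta^\nu+\lambda_m}-G\!\left(-\frac{\lambda_m}{\beta^\nu}\right)\right].$$ -/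

import Mathlib

open MeasureTheory ProbabilityTheory Set Filter
open scoped NNReal ENNReal

noncomputable section

/-- The lower incomplete gamma function `γ(a, x) = ∫₀ˣ e^{-u} u^{a-1} du`. -/
def lowerGamma (a x : ℝ) : ℝ :=
  ∫ u in (0 : ℝ)..x, Real.exp (-u) * u ^ (a - 1)

/-- The upper incomplete gamma function `Γ(a, x) = ∫ₓ^∞ e^{-u} u^{a-1} du`. -/
def upperGamma (a x : ℝ) : ℝ :=
  ∫ u in Ioi x, Real.exp (-u) * u ^ (a - 1)

/-- The Caputo derivative of order `ν ∈ (0, 1]` with base point `0`, of an (absolutely continuous)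
function on `[0, ∞)`; for `ν = 1` it is the ordinary derivative. -/
def caputoDeriv (ν : ℝ) (f : ℝ → ℝ) (t : ℝ) : ℝ :=
  if ν = 1 then deriv f t
  else 1 / Real.Gamma (1 - ν) * ∫ s in (0 : ℝ)..t, deriv f s / (t - s) ^ ν

section Processes

variable {Ω : Type*} [MeasurableSpace Ω]

/-- The state probability `p_n(s) = P(N(s) = n)`, as a function of the real variable `s ≥ 0`
(extended to negative `s` by its value at `0`). -/
def stateProb (P : Measure Ω) (N : ℝ≥0 → Ω → ℕ) (n : ℕ) (s : ℝ) : ℝ :=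
  P.real {ω | N s.toNNReal ω = n}

/-- `N` is a fractional nonlinear birth process of order `ν` with birth rates `lam 1, lam 2, …`
and one progenitor: a counting process with finite values (so that there is no explosion), whose
state probabilities `p_n`, `n ≥ 1`, are locally absolutely continuous and solve
`d^ν p_n / dt^ν = - lam n * p_n + lam (n-1) * p_{n-1}`, `p_n(0) = δ_{n,1}`, with `p_0 = 0`.
The value `lam 0` plays no role. -/
structure IsFractionalBirthProcess (ν : ℝ) (lam : ℕ → ℝ) (P : Measure Ω)
    (N : ℝ≥0 → Ω → ℕ) : Prop where
  measurable : ∀ s, Measurable (N s)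
  monotone : ∀ ω, Monotone fun s => N s ω
  right_continuous : ∀ ω s, ContinuousWithinAt (fun s => N s ω) (Ici s) s
  prob_zero : ∀ s : ℝ, 0 ≤ s → stateProb P N 0 s = 0
  initial : ∀ n : ℕ, 1 ≤ n → stateProb P N n 0 = if n = 1 then 1 else 0
  abs_cont : ∀ n : ℕ, 1 ≤ n → ∀ T : ℝ, 0 < T →
    AbsolutelyContinuousOnInterval (stateProb P N n) 0 T
  evolution : ∀ n : ℕ, 1 ≤ n → ∀ᵐ s ∂(volume.restrict (Ioi (0 : ℝ))),
    caputoDeriv ν (stateProb P N n) s =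
      - lam n * stateProb P N n s + lam (n - 1) * stateProb P N (n - 1) s

/-- The creation time of webpage number `k`, when `τ j` is the time during which exactly `j + 1`
webpages are present. Webpage `0` is the initial one, created at time `0`. -/
def creationTime (τ : ℕ → Ω → ℝ) (k : ℕ) (ω : Ω) : ℝ :=
  ∑ j ∈ Finset.range k, τ j ω

/-- The number of webpages created in `(0, t]`; together with the initial webpage there are
`newPages τ t ω + 1` webpages at time `t`. -/
def newPages (τ : ℕ → Ω → ℝ) (t : ℝ) (ω : Ω) : ℕ :=
  {k : ℕ | 1 ≤ k ∧ creationTime τ k ω ≤ t}.ncard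

/-- The generalized nonlinear Yule model. The webpages form a homogeneous Yule process of rate `β`:
the time `τ j` spent with `j + 1` webpages is exponential of rate `β (j + 1)`, and these times are
independent. From its creation on, the in-links of webpage `k` evolve as the process `N k`, where
the `N k` are fractional nonlinear birth processes, independent of each other and of the webpage
process. The random index `J k` is uniform on `{1, …, k}`; it serves to choose one among `k`
webpages uniformly at random, independently of everything else. -/
structure IsGeneralizedYuleModel (β ν : ℝ) (lam : ℕ → ℝ) (P : Measure Ω)
    (τ : ℕ → Ω → ℝ) (N : ℕ → ℝ≥0 → Ω → ℕ) (J : ℕ → Ω → ℕ) : Prop where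
  measurable_time : ∀ j, Measurable (τ j)
  law_time : ∀ j : ℕ, HasLaw (τ j) (expMeasure (β * ((j : ℝ) + 1))) P
  indep_time : iIndepFun τ P
  birth : ∀ k, IsFractionalBirthProcess ν lam P (N k)
  indep_birth : iIndepFun (fun (k : ℕ) (ω : Ω) (s : ℝ≥0) => N k s ω) P
  measurable_choice : ∀ k, Measurable (J k)
  law_choice : ∀ k : ℕ, 1 ≤ k → HasLaw (J k) (uniformOn (Icc 1 k)) P
  indep_time_choice : IndepFun (fun (ω : Ω) (j : ℕ) => τ j ω) (fun (ω : Ω) (k : ℕ) => J k ω) P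
  indep_birth_rest :
    IndepFun (fun (ω : Ω) (k : ℕ) (s : ℝ≥0) => N k s ω)
      (fun (ω : Ω) => ((fun j : ℕ => τ j ω), (fun k : ℕ => J k ω))) P

/-- The number of in-links, at time `t`, of a webpage chosen uniformly at random among those
created in `(0, t]` (meaningful when there is at least one). -/
def chosenSize (τ : ℕ → Ω → ℝ) (N : ℕ → ℝ≥0 → Ω → ℕ) (J : ℕ → Ω → ℕ) (t : ℝ) (ω : Ω) : ℕ :=
  N (J (newPages τ t ω) ω) (t - creationTime τ (J (newPages τ t ω) ω) ω).toNNReal ω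

/-- The distribution of the number of in-links, at time `t`, of a webpage chosen uniformly at
random among those created in `(0, t]`, given that there is at least one. -/
def sizeProb (P : Measure Ω) (τ : ℕ → Ω → ℝ) (N : ℕ → ℝ≥0 → Ω → ℕ) (J : ℕ → Ω → ℕ)
    (t : ℝ) (n : ℕ) : ℝ :=
  (cond P {ω | 1 ≤ newPages τ t ω}).real {ω | chosenSize τ N J t ω = n}

end Processes

end

/-! ### Incomplete gamma functions -/

/-! The proof reduces the claim to one integral, `IsGeneralizedYuleModel.sizeProb_eq`: the size
probability is `∫₀ᵗ β e^{-βs} p_n(s) ds / (1 - e^{-βt})`, where `p_n` is the common state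
probability of the birth processes. In other words, the age of a uniformly chosen page has the
exponential density truncated to `[0, t]`.

For the age, the sum of `g (t - T_j)` over the creation times is integrated over the event that
exactly `k + 1` pages are created. The result (`lintegral_pageSum_mul_indicator`) is `k + 1` times a
geometric weight times `∫₀ᵗ β e^{-βs} g(s) ds`, so the age profile does not depend on `k`. The
uniform choice cancels `k + 1` and the geometric weights sum to one. Putting `g = p_n` needs the
birth process at a random time independent of it, which `measure_inter_randomTime` supplies.

For `p_n`, applying the Riemann–Liouville integral turns the Caputo equations into Volterra
equations (`sub_eq_rlIntegral_of_caputoDeriv`). Bounded solutions are unique by iterating the kernel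
(`eq_zero_of_eq_const_mul_rlIntegral`), and an explicit solution is a combination of the
Mittag-Leffler functions `E_ν(-λ_m s^ν)`, the initial condition being a Lagrange interpolation
identity (`sum_birthWeight`).

Integrating these power series termwise against `β e^{-βs}` gives the lower gamma form. Since `γ(a,
x) + Γ(a, x) = Γ(a)`, the upper gamma series is the geometric series minus an entire function; this
gives the second form and the continuation. -/

theorem integrableOn_exp_neg_mul_rpow {a : ℝ} (ha : 1 ≤ a) :
    IntegrableOn (fun u : ℝ => Real.exp (-u) * u ^ (a - 1)) (Ioi 0) :=
  Real.GammaIntegral_convergent (by linarith)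

theorem lowerGamma_add_upperGamma {a x : ℝ} (ha : 1 ≤ a) (hx : 0 ≤ x) :
    lowerGamma a x + upperGamma a x = Real.Gamma a := by
  rw [Real.Gamma_eq_integral (by linarith), lowerGamma, upperGamma,
    intervalIntegral.integral_of_le hx, ← setIntegral_union (Ioc_disjoint_Ioi le_rfl)
      measurableSet_Ioi, Ioc_union_Ioi_eq_Ioi hx]
  · exact (integrableOn_exp_neg_mul_rpow ha).mono_set Ioc_subset_Ioi_self
  · exact (integrableOn_exp_neg_mul_rpow ha).mono_set (Ioi_subset_Ioi hx)

theorem lowerGamma_nonneg {a x : ℝ} (hx : 0 ≤ x) : 0 ≤ lowerGamma a x :=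
  intervalIntegral.integral_nonneg hx fun _ hu =>
    mul_nonneg (Real.exp_nonneg _) (Real.rpow_nonneg hu.1 _)

theorem upperGamma_nonneg {a x : ℝ} (hx : 0 ≤ x) : 0 ≤ upperGamma a x :=
  setIntegral_nonneg measurableSet_Ioi fun _ hu =>
    mul_nonneg (Real.exp_nonneg _) (Real.rpow_nonneg (hx.trans (le_of_lt hu)) _)

theorem lowerGamma_le {a x : ℝ} (ha : 1 ≤ a) (hx : 0 ≤ x) :
    lowerGamma a x ≤ x ^ (a - 1) * x := by
  have h := intervalIntegral.norm_integral_le_of_norm_le_const (a := 0) (b := x)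
    (f := fun u : ℝ => Real.exp (-u) * u ^ (a - 1)) (C := x ^ (a - 1)) fun u hu => by
      rw [uIoc_of_le hx] at hu
      have h0 : 0 ≤ u ^ (a - 1) := Real.rpow_nonneg hu.1.le _
      rw [Real.norm_of_nonneg (mul_nonneg (Real.exp_nonneg _) h0)]
      have h1 : Real.exp (-u) ≤ 1 := Real.exp_le_one_iff.2 (by linarith [hu.1])
      have h2 : u ^ (a - 1) ≤ x ^ (a - 1) := Real.rpow_le_rpow hu.1.le hu.2 (by linarith)
      nlinarith
  rw [sub_zero, abs_of_nonneg hx] at h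
  exact (le_abs_self _).trans h

/-- On `(M, ∞)` the Gamma integrand is at least `e^{-u} M^a`. As `M` is free, this elementary bound
shows that Γ outgrows every geometric sequence, and replaces Stirling's formula. -/
theorem rpow_mul_exp_neg_le_Gamma {a M : ℝ} (ha : 0 ≤ a) (hM : 0 < M) :
    M ^ a * Real.exp (-M) ≤ Real.Gamma (a + 1) := by
  have hadd := lowerGamma_add_upperGamma (a := a + 1) (x := M) (by linarith) hM.le
  have hl : 0 ≤ lowerGamma (a + 1) M := lowerGamma_nonneg hM.le
  have hu : M ^ a * Real.exp (-M) ≤ upperGamma (a + 1) M := by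
    rw [← integral_exp_neg_Ioi M, ← integral_const_mul, upperGamma]
    refine setIntegral_mono_on ?_ ?_ measurableSet_Ioi fun u hu => ?_
    · have := (integrableOn_exp_neg_Ioi M).const_mul (M ^ a)
      exact this
    · exact (integrableOn_exp_neg_mul_rpow (by linarith)).mono_set (Ioi_subset_Ioi hM.le)
    · rw [mul_comm, add_sub_cancel_right]
      exact mul_le_mul_of_nonneg_left (Real.rpow_le_rpow hM.le (le_of_lt hu) ha)
        (Real.exp_nonneg _)
  linarith

/-! ### Power series with infinite radius of convergence -/

theorem summable_div_Gamma {ν : ℝ} (hν : 0 < ν) (z : ℝ) :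
    Summable fun r : ℕ => (Real.Gamma (ν * r + 1))⁻¹ * z ^ r := by
  -- `M` is chosen so that `M ^ ν = 2 (|z| + 1)`; the bound on Γ then dominates the series by a
  -- geometric one of ratio `1/2`.
  set M : ℝ := (2 * (|z| + 1)) ^ (1 / ν) with hMdef
  have hpos : 0 < 2 * (|z| + 1) := by positivity
  have hM : 0 < M := Real.rpow_pos_of_pos hpos _
  have hMν : M ^ ν = 2 * (|z| + 1) := by
    rw [hMdef, ← Real.rpow_mul hpos.le, one_div_mul_cancel hν.ne', Real.rpow_one]
  have hgeo : Summable fun r : ℕ => Real.exp M * (1 / 2 : ℝ) ^ r :=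
    (summable_geometric_of_lt_one (by norm_num) (by norm_num)).mul_left _
  refine hgeo.of_norm_bounded fun r => ?_
  have hG := rpow_mul_exp_neg_le_Gamma (a := ν * r) (M := M) (by positivity) hM
  have hMr : M ^ (ν * r) = (2 * (|z| + 1)) ^ r := by
    rw [Real.rpow_mul hM.le, hMν, Real.rpow_natCast]
  rw [hMr] at hG
  have hGpos : 0 < Real.Gamma (ν * r + 1) := Real.Gamma_pos_of_pos (by positivity)
  rw [norm_mul, norm_inv, norm_pow, Real.norm_of_nonneg hGpos.le, Real.norm_eq_abs,
    inv_mul_le_iff₀ hGpos]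
  calc |z| ^ r ≤ (|z| + 1) ^ r := by gcongr; linarith
    _ = ((2 * (|z| + 1)) ^ r * Real.exp (-M)) * (Real.exp M * (1 / 2) ^ r) := by
        rw [mul_pow, Real.exp_neg, one_div, inv_pow]
        have := Real.exp_ne_zero M
        field_simp
    _ ≤ _ := by gcongr

theorem summable_lowerGamma_div_Gamma {ν x : ℝ} (hν : 0 < ν) (hx : 0 ≤ x) (z : ℝ) :
    Summable fun r : ℕ => lowerGamma (ν * r + 1) x / Real.Gamma (ν * r + 1) * z ^ r := by
  have hs := ((summable_div_Gamma hν (x ^ ν * |z|)).mul_left x)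
  refine hs.of_norm_bounded fun r => ?_
  have hGpos : 0 < Real.Gamma (ν * r + 1) := Real.Gamma_pos_of_pos (by positivity)
  have hl := lowerGamma_le (a := ν * r + 1) (x := x) (by simp; positivity) hx
  have hl0 : 0 ≤ lowerGamma (ν * r + 1) x := lowerGamma_nonneg hx
  rw [add_sub_cancel_right, Real.rpow_mul hx, Real.rpow_natCast] at hl
  rw [norm_mul, norm_pow, Real.norm_of_nonneg (div_nonneg hl0 hGpos.le), Real.norm_eq_abs, mul_pow,
    div_mul_eq_mul_div, div_le_iff₀ hGpos]
  calc _ ≤ (x ^ ν) ^ r * x * |z| ^ r := by gcongr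
    _ = _ := by field_simp

theorem lowerGamma_div_Gamma {ν x : ℝ} (hν : 0 < ν) (hx : 0 ≤ x) (r : ℕ) :
    lowerGamma (ν * r + 1) x / Real.Gamma (ν * r + 1) =
      1 - upperGamma (ν * r + 1) x / Real.Gamma (ν * r + 1) := by
  have hGpos : 0 < Real.Gamma (ν * r + 1) := Real.Gamma_pos_of_pos (by positivity)
  have h := lowerGamma_add_upperGamma (a := ν * r + 1) (x := x) (by simp; positivity) hx
  field_simp
  linarith

theorem upperGamma_div_Gamma_mem {ν x : ℝ} (hν : 0 < ν) (hx : 0 ≤ x) (r : ℕ) :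
    upperGamma (ν * r + 1) x / Real.Gamma (ν * r + 1) ∈ Icc (0 : ℝ) 1 := by
  have hGpos : 0 < Real.Gamma (ν * r + 1) := Real.Gamma_pos_of_pos (by positivity)
  have h := lowerGamma_add_upperGamma (a := ν * r + 1) (x := x) (by simp; positivity) hx
  have h1 : 0 ≤ lowerGamma (ν * r + 1) x := lowerGamma_nonneg hx
  exact ⟨div_nonneg (upperGamma_nonneg hx) hGpos.le, (div_le_one hGpos).2 (by linarith)⟩

theorem summable_upperGamma_div_Gamma {ν x z : ℝ} (hν : 0 < ν) (hx : 0 ≤ x) (hz : |z| < 1) :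
    Summable fun r : ℕ => upperGamma (ν * r + 1) x / Real.Gamma (ν * r + 1) * z ^ r := by
  refine (summable_geometric_of_lt_one (abs_nonneg z) hz).of_norm_bounded fun r => ?_
  have h := upperGamma_div_Gamma_mem hν hx r
  rw [norm_mul, norm_pow, Real.norm_of_nonneg h.1, Real.norm_eq_abs]
  exact mul_le_of_le_one_left (by positivity) h.2

theorem tsum_lowerGamma_eq_sub {ν x z : ℝ} (hν : 0 < ν) (hx : 0 ≤ x) (hz : |z| < 1) :
    ∑' r : ℕ, lowerGamma (ν * r + 1) x / Real.Gamma (ν * r + 1) * z ^ r =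
      (1 - z)⁻¹ - ∑' r : ℕ, upperGamma (ν * r + 1) x / Real.Gamma (ν * r + 1) * z ^ r := by
  have hgeo := summable_geometric_of_abs_lt_one hz
  rw [← tsum_geometric_of_abs_lt_one hz,
    ← hgeo.tsum_sub (summable_upperGamma_div_Gamma hν hx hz)]
  refine tsum_congr fun r => ?_
  rw [lowerGamma_div_Gamma hν hx]
  ring

theorem differentiable_tsum_mul_pow {a : ℕ → ℝ} (ha : ∀ R : ℝ, Summable fun r => a r * R ^ r) :
    Differentiable ℂ fun z : ℂ => ∑' r : ℕ, (a r : ℂ) * z ^ r := by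
  intro z
  have h : DifferentiableOn ℂ (fun z : ℂ => ∑' r : ℕ, (a r : ℂ) * z ^ r)
      (Metric.ball 0 (‖z‖ + 1)) := by
    refine Complex.differentiableOn_tsum_of_summable_norm (ha (‖z‖ + 1)).norm (fun r => ?_)
      Metric.isOpen_ball fun r w hw => ?_
    · fun_prop
    · rw [mem_ball_zero_iff] at hw
      rw [norm_mul, norm_mul, norm_pow, norm_pow, Complex.norm_real,
        Real.norm_of_nonneg (show 0 ≤ ‖z‖ + 1 by positivity)]
      gcongr
  exact (h z (by simp)).differentiableAt (Metric.isOpen_ball.mem_nhds (by simp))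

theorem continuous_tsum_mul_pow {a : ℕ → ℝ} (ha : ∀ R : ℝ, Summable fun r => a r * R ^ r) :
    Continuous fun z : ℝ => ∑' r : ℕ, a r * z ^ r := by
  have h := Complex.continuous_re.comp
    ((differentiable_tsum_mul_pow ha).continuous.comp Complex.continuous_ofReal)
  refine h.congr fun z => ?_
  simp only [Function.comp_apply]
  rw [← Complex.ofReal_re (∑' r : ℕ, a r * z ^ r), Complex.ofReal_tsum]
  simp

/-- Dominated convergence with bound `‖k s‖ ‖a r * B ^ r‖`, where `B` bounds `φ` on `[0, T]`. The
kernel `k` need only be integrable, because the Riemann–Liouville kernel is singular at the endpoint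
when `ν < 1`. -/
theorem hasSum_intervalIntegral_mul_pow {a : ℕ → ℝ} (ha : ∀ R : ℝ, Summable fun r => a r * R ^ r)
    {k φ : ℝ → ℝ} {T : ℝ} (hT : 0 ≤ T) (hk : IntervalIntegrable k volume 0 T)
    (hφ : Continuous φ) :
    HasSum (fun r : ℕ => ∫ s in (0 : ℝ)..T, k s * (a r * φ s ^ r))
      (∫ s in (0 : ℝ)..T, k s * ∑' r : ℕ, a r * φ s ^ r) := by
  obtain ⟨B, hB⟩ := (isCompact_Icc (a := (0 : ℝ)) (b := T)).exists_bound_of_continuousOn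
    hφ.continuousOn
  refine intervalIntegral.hasSum_integral_of_dominated_convergence
    (fun r s => ‖k s‖ * ‖a r * B ^ r‖) (fun r => ?_) (fun r => ?_) ?_ ?_ ?_
  · rw [uIoc_of_le hT]
    exact hk.1.aestronglyMeasurable.mul
      ((hφ.pow r).const_mul (a r)).measurable.aestronglyMeasurable
  · refine ae_of_all _ fun s hs => ?_
    rw [uIoc_of_le hT] at hs
    rw [norm_mul, norm_mul (a r), norm_mul (a r), norm_pow, norm_pow]
    have h1 := hB s ⟨hs.1.le, hs.2⟩
    have h2 : ‖φ s‖ ≤ ‖B‖ := h1.trans (le_abs_self B)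
    gcongr
  · exact ae_of_all _ fun s _ => (ha B).norm.mul_left _
  · simp_rw [tsum_mul_left]
    exact hk.norm.mul_const _
  · exact ae_of_all _ fun s _ => (ha (φ s)).hasSum.mul_left _

/-! ### The Riemann–Liouville integral and the Caputo derivative -/

/-- The Riemann–Liouville integral of order `ν` with base point `0`. -/
noncomputable def rlIntegral (ν : ℝ) (f : ℝ → ℝ) (t : ℝ) : ℝ :=
  ∫ s in (0 : ℝ)..t, (t - s) ^ (ν - 1) / Real.Gamma ν * f s

theorem integral_sub_rpow_mul_rpow {p q t : ℝ} (hp : 0 < p) (hq : 0 < q) (ht : 0 < t) :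
    ∫ s in (0 : ℝ)..t, (t - s) ^ (p - 1) * s ^ (q - 1) =
      t ^ (p + q - 1) * (Real.Gamma p * Real.Gamma q / Real.Gamma (p + q)) := by
  have h := Complex.betaIntegral_scaled q p ht
  rw [Complex.betaIntegral_eq_Gamma_mul_div _ _ (by simpa) (by simpa)] at h
  have hl : (∫ x : ℝ in (0 : ℝ)..t, (x : ℂ) ^ ((q : ℂ) - 1) * ((t : ℂ) - x) ^ ((p : ℂ) - 1)) =
      ((∫ s in (0 : ℝ)..t, (t - s) ^ (p - 1) * s ^ (q - 1) : ℝ) : ℂ) := by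
    rw [← intervalIntegral.integral_ofReal]
    refine intervalIntegral.integral_congr fun x hx => ?_
    rw [uIcc_of_le ht.le] at hx
    rw [Complex.ofReal_mul, Complex.ofReal_cpow (sub_nonneg.2 hx.2), Complex.ofReal_cpow hx.1]
    push_cast
    ring
  rw [hl] at h
  apply Complex.ofReal_injective
  rw [h]
  push_cast
  rw [Complex.ofReal_cpow ht.le, ← Complex.Gamma_ofReal, ← Complex.Gamma_ofReal,
    ← Complex.Gamma_ofReal]
  push_cast
  rw [add_comm (q : ℂ) p, mul_comm (Complex.Gamma q)]

theorem intervalIntegrable_sub_rpow_mul_rpow {p q t : ℝ} (hp : 0 < p) (hq : 0 < q) (ht : 0 < t) :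
    IntervalIntegrable (fun s => (t - s) ^ (p - 1) * s ^ (q - 1)) volume 0 t := by
  -- A non-integrable function has integral `0` by convention, whereas the Beta value is positive.
  by_contra hcon
  have h := integral_sub_rpow_mul_rpow hp hq ht
  rw [intervalIntegral.integral_undef hcon] at h
  have h1 := Real.Gamma_pos_of_pos hp
  have h2 := Real.Gamma_pos_of_pos hq
  have h3 := Real.Gamma_pos_of_pos (add_pos hp hq)
  have h4 := Real.rpow_pos_of_pos ht (p + q - 1)
  have : 0 < t ^ (p + q - 1) * (Real.Gamma p * Real.Gamma q / Real.Gamma (p + q)) := by positivity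
  linarith

theorem intervalIntegrable_rlKernel {ν t : ℝ} (hν : 0 < ν) :
    IntervalIntegrable (fun s => (t - s) ^ (ν - 1) / Real.Gamma ν) volume 0 t := by
  have h := (intervalIntegral.intervalIntegrable_rpow' (a := 0) (b := t) (r := ν - 1)
    (by linarith)).comp_sub_left t
  simp only [sub_zero, sub_self] at h
  exact h.symm.div_const _

theorem rlIntegral_rpow {ν a t : ℝ} (hν : 0 < ν) (ha : 0 ≤ a) (ht : 0 ≤ t) :
    rlIntegral ν (fun s => s ^ a / Real.Gamma (a + 1)) t = t ^ (a + ν) / Real.Gamma (a + ν + 1) := by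
  rcases ht.eq_or_lt with rfl | ht
  · rw [rlIntegral, intervalIntegral.integral_same, Real.zero_rpow (by positivity), zero_div]
  · have h := integral_sub_rpow_mul_rpow hν (show 0 < a + 1 by positivity) ht
    have h1 := (Real.Gamma_pos_of_pos hν).ne'
    have h2 := (Real.Gamma_pos_of_pos (show 0 < a + 1 by positivity)).ne'
    simp only [add_sub_cancel_right] at h
    have : rlIntegral ν (fun s => s ^ a / Real.Gamma (a + 1)) t =
        (Real.Gamma ν * Real.Gamma (a + 1))⁻¹ * ∫ s in (0 : ℝ)..t, (t - s) ^ (ν - 1) * s ^ a := by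
      rw [rlIntegral, ← intervalIntegral.integral_const_mul]
      congr 1 with s
      field_simp
    rw [this, h, show ν + (a + 1) - 1 = a + ν by ring, show ν + (a + 1) = a + ν + 1 by ring]
    field_simp

theorem rlIntegral_integrand_rpow_integrable {ν a t : ℝ} (hν : 0 < ν) (ha : 0 ≤ a) :
    IntervalIntegrable (fun s => (t - s) ^ (ν - 1) / Real.Gamma ν * (s ^ a / Real.Gamma (a + 1)))
      volume 0 t := by
  refine (intervalIntegrable_rlKernel hν).mul_continuousOn ?_
  exact ((Real.continuous_rpow_const ha).div_const _).continuousOn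

/-- A fractional Grönwall argument: feeding the bound on `d` back into the equation `r` times gives
`D |c|^r t^{νr} / Γ(νr + 1)`, the general term of a convergent series, hence a bound tending to `0`.
-/
theorem eq_zero_of_eq_const_mul_rlIntegral {ν T c D : ℝ} (hν : 0 < ν) {d : ℝ → ℝ}
    (hD : ∀ t ∈ Icc 0 T, |d t| ≤ D) (hd : ∀ t ∈ Icc 0 T, d t = c * rlIntegral ν d t) :
    ∀ t ∈ Icc 0 T, d t = 0 := by
  have key : ∀ r : ℕ, ∀ t ∈ Icc 0 T,
      |d t| ≤ D * |c| ^ r * (t ^ (ν * r) / Real.Gamma (ν * r + 1)) := by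
    intro r
    induction r with
    | zero => intro t ht; simpa using hD t ht
    | succ r ih =>
      intro t ht
      have hG := Real.Gamma_pos_of_pos hν
      have hle : |rlIntegral ν d t| ≤
          rlIntegral ν (fun s => D * |c| ^ r * (s ^ (ν * r) / Real.Gamma (ν * r + 1))) t := by
        rw [← Real.norm_eq_abs]
        refine intervalIntegral.norm_integral_le_of_norm_le ht.1
          (ae_of_all _ fun s hs => ?_) ?_
        · have h0 : 0 ≤ (t - s) ^ (ν - 1) / Real.Gamma ν :=
            div_nonneg (Real.rpow_nonneg (sub_nonneg.2 hs.2) _) hG.le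
          rw [norm_mul, Real.norm_of_nonneg h0, Real.norm_eq_abs]
          exact mul_le_mul_of_nonneg_left (ih s ⟨hs.1.le, hs.2.trans ht.2⟩) h0
        · refine ((rlIntegral_integrand_rpow_integrable (t := t) hν
            (show 0 ≤ ν * r by positivity)).const_mul (D * |c| ^ r)).congr ?_
          exact fun s _ => by simp only; ring
      have hval : rlIntegral ν (fun s => D * |c| ^ r * (s ^ (ν * r) / Real.Gamma (ν * r + 1))) t =
          D * |c| ^ r * rlIntegral ν (fun s => s ^ (ν * r) / Real.Gamma (ν * r + 1)) t := by
        rw [rlIntegral, rlIntegral, ← intervalIntegral.integral_const_mul]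
        congr 1 with s
        ring
      rw [hval, rlIntegral_rpow hν (by positivity) ht.1] at hle
      rw [hd t ht, abs_mul, pow_succ, show ν * ((r + 1 : ℕ) : ℝ) = ν * r + ν by push_cast; ring]
      nlinarith [mul_le_mul_of_nonneg_left hle (abs_nonneg c)]
  intro t ht
  have hsum := (summable_div_Gamma hν (|c| * t ^ ν)).tendsto_atTop_zero.const_mul D
  rw [mul_zero] at hsum
  have h0 : |d t| ≤ 0 := by
    refine ge_of_tendsto' hsum fun r => (key r t ht).trans_eq ?_
    rw [Real.rpow_mul ht.1, Real.rpow_natCast, mul_pow]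
    ring
  exact abs_nonpos_iff.1 h0

/-- A translated Beta integral with parameters `ν` and `1 - ν`: the powers of `t - u` cancel, so the
value is independent of `u`. The indicator lets Fubini run on a square instead of a triangle. -/
theorem integral_indicator_rpow_mul_rpow {ν t u : ℝ} (hν : 0 < ν) (hν1 : ν < 1)
    (hu : u ∈ Ioo 0 t) :
    Integrable (fun s => (Ioi u).indicator (fun s => (t - s) ^ (ν - 1) / (s - u) ^ ν) s)
        (volume.restrict (Ioo 0 t)) ∧
      ∫ s in Ioo 0 t, (Ioi u).indicator (fun s => (t - s) ^ (ν - 1) / (s - u) ^ ν) s =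
        Real.Gamma ν * Real.Gamma (1 - ν) := by
  have htu : 0 < t - u := sub_pos.2 hu.2
  have hset : Ioo 0 t ∩ Ioi u = Ioo u t := by
    ext s
    simp only [mem_inter_iff, mem_Ioo, mem_Ioi]
    constructor
    · rintro ⟨⟨_, h⟩, h'⟩; exact ⟨h', h⟩
    · rintro ⟨h, h'⟩; exact ⟨⟨hu.1.trans h, h'⟩, h⟩
  have hcongr : EqOn (fun s => (t - u - (s - u)) ^ (ν - 1) * (s - u) ^ (1 - ν - 1))
      (fun s => (t - s) ^ (ν - 1) / (s - u) ^ ν) (Ioo u t) := fun s hs => by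
    have : 0 ≤ s - u := (sub_pos.2 hs.1).le
    simp only
    rw [show (1 - ν - 1) = -ν by ring, Real.rpow_neg this, div_eq_mul_inv]
    congr 2
    ring
  have hint := (intervalIntegrable_sub_rpow_mul_rpow hν (sub_pos.2 hν1) htu).comp_sub_right u
  have hval := integral_sub_rpow_mul_rpow hν (sub_pos.2 hν1) htu
  rw [zero_add, sub_add_cancel] at hint
  have hval2 := intervalIntegral.integral_comp_sub_right (a := u) (b := t)
    (fun s => (t - u - s) ^ (ν - 1) * s ^ (1 - ν - 1)) u
  rw [sub_self, hval] at hval2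
  constructor
  · rw [integrable_indicator_iff measurableSet_Ioi, IntegrableOn, Measure.restrict_restrict
      measurableSet_Ioi, inter_comm, hset]
    exact ((intervalIntegrable_iff_integrableOn_Ioo_of_le hu.2.le).1 hint).congr_fun hcongr
      measurableSet_Ioo
  · rw [setIntegral_indicator measurableSet_Ioi, hset, ← setIntegral_congr_fun measurableSet_Ioo
      hcongr, ← integral_Ioc_eq_integral_Ioo, ← intervalIntegral.integral_of_le hu.2.le, hval2]
    simp

/-- This is the semigroup law: the integral of order `ν` of the one of order `1 - ν` is the ordinary
integral. After exchanging the integrals, the inner kernel integrates to the constant `Γ(ν) Γ(1 -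
ν)`. -/
theorem rlIntegral_fractional_deriv {ν t : ℝ} (hν : 0 < ν) (hν1 : ν < 1) (ht : 0 < t)
    {g : ℝ → ℝ} (hg : Measurable g) (hgi : IntervalIntegrable g volume 0 t) :
    rlIntegral ν (fun s => 1 / Real.Gamma (1 - ν) * ∫ u in (0 : ℝ)..s, g u / (s - u) ^ ν) t =
      ∫ u in (0 : ℝ)..t, g u := by
  have hG := (Real.Gamma_pos_of_pos hν).ne'
  have hG' := (Real.Gamma_pos_of_pos (sub_pos.2 hν1)).ne'
  set F : ℝ → ℝ → ℝ := fun s u =>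
    (Ioi u).indicator (fun s => (t - s) ^ (ν - 1) / (s - u) ^ ν) s * g u with hF
  have hFm : Measurable (Function.uncurry F) := by
    have : Function.uncurry F = fun p : ℝ × ℝ =>
        ({p : ℝ × ℝ | p.2 < p.1}.indicator
          (fun p => (t - p.1) ^ (ν - 1) / (p.1 - p.2) ^ ν) p) * g p.2 := by
      ext ⟨s, u⟩
      simp [hF, Function.uncurry, indicator]
    rw [this]
    refine Measurable.mul (Measurable.indicator ?_ ?_) (hg.comp measurable_snd)
    · exact ((measurable_const.sub measurable_fst).pow_const _).div
        ((measurable_fst.sub measurable_snd).pow_const _)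
    · exact measurableSet_lt measurable_snd measurable_fst
  have hgi' : Integrable g (volume.restrict (Ioo 0 t)) :=
    (intervalIntegrable_iff_integrableOn_Ioo_of_le ht.le).1 hgi
  have hinner : ∀ u ∈ Ioo 0 t, ∫ s in Ioo 0 t, F s u =
      Real.Gamma ν * Real.Gamma (1 - ν) * g u := fun u hu => by
    simp only [hF]
    rw [integral_mul_const, (integral_indicator_rpow_mul_rpow hν hν1 hu).2]
  have hFi : Integrable (Function.uncurry F)
      ((volume.restrict (Ioo 0 t)).prod (volume.restrict (Ioo 0 t))) := by
    -- The kernel is nonnegative, so integrating in `s` first reduces integrability on the square to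
    -- that of `g`.
    rw [integrable_prod_iff' hFm.aestronglyMeasurable]
    constructor
    · filter_upwards [ae_restrict_mem measurableSet_Ioo] with u hu
      exact (integral_indicator_rpow_mul_rpow hν hν1 hu).1.mul_const (g u)
    · refine (hgi'.norm.const_mul (Real.Gamma ν * Real.Gamma (1 - ν))).congr ?_
      filter_upwards [ae_restrict_mem measurableSet_Ioo] with u hu
      rw [← (integral_indicator_rpow_mul_rpow hν hν1 hu).2, ← integral_mul_const]
      refine setIntegral_congr_fun measurableSet_Ioo fun s hs => ?_
      simp only [Function.uncurry, hF]
      rw [norm_mul]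
      congr 1
      refine (Real.norm_of_nonneg ?_).symm
      rw [indicator_apply]
      split_ifs with hsu
      · exact div_nonneg (Real.rpow_nonneg (sub_nonneg.2 hs.2.le) _)
          (Real.rpow_nonneg (sub_nonneg.2 (le_of_lt hsu)) _)
      · exact le_rfl
  have houter : ∀ s ∈ Ioo 0 t, ∫ u in Ioo 0 t, F s u =
      (t - s) ^ (ν - 1) * ∫ u in (0 : ℝ)..s, g u / (s - u) ^ ν := fun s hs => by
    have : ∀ u, F s u =
        (Iio s).indicator (fun u => (t - s) ^ (ν - 1) * (g u / (s - u) ^ ν)) u := fun u => by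
      simp only [hF, indicator_apply, mem_Ioi, mem_Iio]
      split_ifs
      · ring
      · ring
    simp_rw [this]
    have hset : Ioo 0 t ∩ Iio s = Ioo 0 s := by
      rw [Ioo_inter_Iio, min_eq_right hs.2.le]
    rw [setIntegral_indicator measurableSet_Iio, hset, integral_const_mul,
      intervalIntegral.integral_of_le hs.1.le, integral_Ioc_eq_integral_Ioo]
  calc _ = ∫ s in Ioo 0 t, (Real.Gamma ν * Real.Gamma (1 - ν))⁻¹ * ∫ u in Ioo 0 t, F s u := by
        rw [rlIntegral, intervalIntegral.integral_of_le ht.le, integral_Ioc_eq_integral_Ioo]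
        refine setIntegral_congr_fun measurableSet_Ioo fun s hs => ?_
        rw [houter s hs]
        field_simp
    _ = (Real.Gamma ν * Real.Gamma (1 - ν))⁻¹ * ∫ u in Ioo 0 t, ∫ s in Ioo 0 t, F s u := by
        rw [integral_const_mul, integral_integral_swap hFi]
    _ = _ := by
        rw [setIntegral_congr_fun measurableSet_Ioo hinner, integral_const_mul,
          intervalIntegral.integral_of_le ht.le, integral_Ioc_eq_integral_Ioo]
        field_simp

/-- The integral of order `ν` of the Caputo derivative is `∫ f'`, which is `f t - f 0` by absolute
continuity. An equation valid almost everywhere suffices, as it is only integrated. -/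
theorem sub_eq_rlIntegral_of_caputoDeriv {ν : ℝ} (hν : 0 < ν) (hν1 : ν ≤ 1) {f h : ℝ → ℝ}
    (hf : ∀ T : ℝ, 0 < T → AbsolutelyContinuousOnInterval f 0 T)
    (hfh : ∀ᵐ s ∂(volume.restrict (Ioi (0 : ℝ))), caputoDeriv ν f s = h s) {t : ℝ} (ht : 0 ≤ t) :
    f t - f 0 = rlIntegral ν h t := by
  rcases ht.eq_or_lt with rfl | ht
  · simp [rlIntegral]
  rw [← (hf t ht).integral_deriv_eq_sub]
  have hcongr : rlIntegral ν h t = rlIntegral ν (caputoDeriv ν f) t := by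
    rw [rlIntegral, rlIntegral, intervalIntegral.integral_of_le ht.le,
      intervalIntegral.integral_of_le ht.le]
    refine integral_congr_ae ?_
    filter_upwards [ae_restrict_of_ae_restrict_of_subset Ioc_subset_Ioi_self hfh] with s hs
    rw [hs]
  rw [hcongr]
  rcases hν1.eq_or_lt with rfl | hν1
  · refine intervalIntegral.integral_congr fun s _ => ?_
    simp [caputoDeriv]
  · rw [← rlIntegral_fractional_deriv hν hν1 ht (measurable_deriv f)
      (hf t ht).intervalIntegrable_deriv]
    refine intervalIntegral.integral_congr fun s _ => ?_
    simp [caputoDeriv, hν1.ne]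

theorem rlIntegral_congr {ν t : ℝ} (ht : 0 ≤ t) {f g : ℝ → ℝ} (h : ∀ s, 0 ≤ s → f s = g s) :
    rlIntegral ν f t = rlIntegral ν g t := by
  refine intervalIntegral.integral_congr fun s hs => ?_
  rw [uIcc_of_le ht] at hs
  simp only [h s hs.1]

theorem rlIntegral_linear {ν t : ℝ} (hν : 0 < ν) {f g : ℝ → ℝ} (hf : Continuous f)
    (hg : Continuous g) (a b : ℝ) :
    rlIntegral ν (fun s => a * f s + b * g s) t = a * rlIntegral ν f t + b * rlIntegral ν g t := by
  simp only [rlIntegral]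
  rw [← intervalIntegral.integral_const_mul, ← intervalIntegral.integral_const_mul,
    ← intervalIntegral.integral_add]
  · congr 1 with s
    ring
  · exact ((intervalIntegrable_rlKernel hν).mul_continuousOn hf.continuousOn).const_mul _
  · exact ((intervalIntegrable_rlKernel hν).mul_continuousOn hg.continuousOn).const_mul _

theorem rlIntegral_const_mul_sum {ν t : ℝ} (hν : 0 < ν) {ι : Type*} (S : Finset ι)
    {f : ι → ℝ → ℝ} (hf : ∀ i, Continuous (f i)) (C : ℝ) (a : ι → ℝ) :
    rlIntegral ν (fun s => C * ∑ i ∈ S, a i * f i s) t =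
      C * ∑ i ∈ S, a i * rlIntegral ν (f i) t := by
  simp only [rlIntegral]
  simp_rw [← intervalIntegral.integral_const_mul (a := (0 : ℝ)) (b := t)]
  rw [← intervalIntegral.integral_finsetSum, ← intervalIntegral.integral_const_mul]
  · congr 1 with s
    rw [Finset.mul_sum, Finset.mul_sum, Finset.mul_sum]
    exact Finset.sum_congr rfl fun i _ => by ring
  · exact fun i _ =>
      ((intervalIntegrable_rlKernel hν).mul_continuousOn (hf i).continuousOn).const_mul _

/-! ### The Mittag-Leffler function -/

/-- The Mittag-Leffler function `E_ν(z) = ∑ z ^ r / Γ(ν r + 1)`. -/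
noncomputable def mittagLeffler (ν z : ℝ) : ℝ :=
  ∑' r : ℕ, (Real.Gamma (ν * r + 1))⁻¹ * z ^ r

theorem continuous_mittagLeffler {ν : ℝ} (hν : 0 < ν) : Continuous (mittagLeffler ν) :=
  continuous_tsum_mul_pow (summable_div_Gamma hν)

theorem continuous_const_mul_rpow {ν : ℝ} (hν : 0 < ν) (c : ℝ) :
    Continuous fun s : ℝ => c * s ^ ν :=
  (Real.continuous_rpow_const hν.le).const_mul c

theorem continuous_mittagLeffler_comp {ν : ℝ} (hν : 0 < ν) (c : ℝ) :
    Continuous fun s : ℝ => mittagLeffler ν (c * s ^ ν) :=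
  (continuous_mittagLeffler hν).comp (continuous_const_mul_rpow hν c)

/-- Fractional integration sends `s^{νr} / Γ(νr + 1)` to the same expression with `r + 1`, so it
shifts the power series by one index and only the constant term is left over. -/
theorem mittagLeffler_eq_one_add_rlIntegral {ν t : ℝ} (hν : 0 < ν) (ht : 0 ≤ t) (c : ℝ) :
    mittagLeffler ν (c * t ^ ν) =
      1 + c * rlIntegral ν (fun s => mittagLeffler ν (c * s ^ ν)) t := by
  have h := (hasSum_intervalIntegral_mul_pow (summable_div_Gamma hν) ht
    (intervalIntegrable_rlKernel (t := t) hν) (continuous_const_mul_rpow hν c)).mul_left c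
  have hterm : ∀ r : ℕ, c * ∫ s in (0 : ℝ)..t, (t - s) ^ (ν - 1) / Real.Gamma ν *
      ((Real.Gamma (ν * r + 1))⁻¹ * (c * s ^ ν) ^ r) =
      (Real.Gamma (ν * (r + 1 : ℕ) + 1))⁻¹ * (c * t ^ ν) ^ (r + 1) := fun r => by
    have h1 : ∫ s in (0 : ℝ)..t, (t - s) ^ (ν - 1) / Real.Gamma ν *
        ((Real.Gamma (ν * r + 1))⁻¹ * (c * s ^ ν) ^ r) =
        c ^ r * rlIntegral ν (fun s => s ^ (ν * r) / Real.Gamma (ν * r + 1)) t := by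
      rw [rlIntegral, ← intervalIntegral.integral_const_mul]
      refine intervalIntegral.integral_congr fun s hs => ?_
      rw [uIcc_of_le ht] at hs
      rw [Real.rpow_mul hs.1, Real.rpow_natCast, mul_pow]
      ring
    rw [h1, rlIntegral_rpow hν (by positivity) ht,
      show ν * r + ν = ν * ((r + 1 : ℕ) : ℝ) by push_cast; ring, Real.rpow_mul ht,
      Real.rpow_natCast, mul_pow]
    ring
  simp_rw [hterm] at h
  rw [mittagLeffler, (summable_div_Gamma hν (c * t ^ ν)).tsum_eq_zero_add, h.tsum_eq]
  simp [rlIntegral, mittagLeffler]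

/-! ### State probabilities -/

/-- The coefficient `1 / ∏_{l ≠ m} (λ_l - λ_m)`, where `1 ≤ l ≤ n`. -/
noncomputable def birthWeight (lam : ℕ → ℝ) (n m : ℕ) : ℝ :=
  1 / ∏ l ∈ (Finset.Icc 1 n).erase m, (lam l - lam m)

/-- The state probabilities of the fractional nonlinear birth process. -/
noncomputable def birthSolution (ν : ℝ) (lam : ℕ → ℝ) (n : ℕ) (s : ℝ) : ℝ :=
  (∏ h ∈ Finset.Icc 1 (n - 1), lam h) *
    ∑ m ∈ Finset.Icc 1 n, birthWeight lam n m * mittagLeffler ν (-lam m * s ^ ν)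

theorem continuous_birthSolution {ν : ℝ} (hν : 0 < ν) (lam : ℕ → ℝ) (n : ℕ) :
    Continuous (birthSolution ν lam n) :=
  (continuous_finsetSum _ fun m _ =>
    (continuous_mittagLeffler_comp hν (-lam m)).const_mul _).const_mul _

/-- The sum is the coefficient of degree `n - 1` of the Lagrange interpolant of the constant
polynomial `1`. It encodes the initial condition, since every Mittag-Leffler factor is `1` at time
`0`. -/
theorem sum_birthWeight {lam : ℕ → ℝ} (hdist : Set.InjOn lam (Set.Ici 1)) {n : ℕ} (hn : 1 ≤ n) :
    ∑ m ∈ Finset.Icc 1 n, birthWeight lam n m = if n = 1 then 1 else 0 := by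
  -- The nodes are `-λ_m`, so that the node differences are exactly `λ_l - λ_m`.
  have hinj : Set.InjOn (fun k => -lam k) (Finset.Icc 1 n : Finset ℕ) := fun a ha b hb hab =>
    hdist (Finset.mem_Icc.1 ha).1 (Finset.mem_Icc.1 hb).1 (neg_injective hab)
  have h := Lagrange.coeff_eq_sum hinj (P := 1) (by
    rw [Polynomial.degree_one, Nat.card_Icc]
    exact_mod_cast (by omega : 0 < n + 1 - 1))
  rw [Nat.card_Icc, Nat.add_sub_cancel, Polynomial.coeff_one] at h
  have h' : (if n = 1 then (1 : ℝ) else 0) = if n - 1 = 0 then 1 else 0 := by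
    congr 1
    exact propext (by omega)
  rw [h', h]
  refine Finset.sum_congr rfl fun m _ => ?_
  rw [Polynomial.eval_one, birthWeight]
  congr 1
  exact Finset.prod_congr rfl fun l _ => by ring

theorem birthWeight_eq_mul_succ {lam : ℕ → ℝ} (hdist : Set.InjOn lam (Set.Ici 1)) {n m : ℕ}
    (hm : m ∈ Finset.Icc 1 n) :
    birthWeight lam n m = (lam (n + 1) - lam m) * birthWeight lam (n + 1) m := by
  rw [Finset.mem_Icc] at hm
  have hne : lam (n + 1) - lam m ≠ 0 := fun h => by
    have := hdist (show 1 ≤ n + 1 by omega) hm.1 (sub_eq_zero.1 h)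
    omega
  have hset : (Finset.Icc 1 (n + 1)).erase m = insert (n + 1) ((Finset.Icc 1 n).erase m) := by
    ext l
    simp only [Finset.mem_erase, Finset.mem_Icc, Finset.mem_insert]
    omega
  rw [birthWeight, birthWeight, hset, Finset.prod_insert (by simp)]
  field_simp

theorem birthSolution_one_eq {ν t : ℝ} (hν : 0 < ν) (ht : 0 ≤ t) (lam : ℕ → ℝ) :
    birthSolution ν lam 1 t = 1 - lam 1 * rlIntegral ν (birthSolution ν lam 1) t := by
  have h : birthSolution ν lam 1 = fun s => mittagLeffler ν (-lam 1 * s ^ ν) := by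
    ext s
    simp [birthSolution, birthWeight]
  rw [h]
  simp only
  rw [mittagLeffler_eq_one_add_rlIntegral hν ht]
  ring

theorem birthSolution_succ_eq {ν t : ℝ} (hν : 0 < ν) (ht : 0 ≤ t) {lam : ℕ → ℝ}
    (hdist : Set.InjOn lam (Set.Ici 1)) {n : ℕ} (hn : 1 ≤ n) :
    birthSolution ν lam (n + 1) t = -lam (n + 1) * rlIntegral ν (birthSolution ν lam (n + 1)) t +
      lam n * rlIntegral ν (birthSolution ν lam n) t := by
  have hI : ∀ k, rlIntegral ν (birthSolution ν lam k) t =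
      (∏ h ∈ Finset.Icc 1 (k - 1), lam h) * ∑ m ∈ Finset.Icc 1 k, birthWeight lam k m *
        rlIntegral ν (fun s => mittagLeffler ν (-lam m * s ^ ν)) t := fun k =>
    rlIntegral_const_mul_sum hν _ (fun m => continuous_mittagLeffler_comp hν (-lam m)) _ _
  have hprod : ∏ h ∈ Finset.Icc 1 (n + 1 - 1), lam h =
      (∏ h ∈ Finset.Icc 1 (n - 1), lam h) * lam n := by
    obtain ⟨k, rfl⟩ : ∃ k, n = k + 1 := ⟨n - 1, by omega⟩
    rw [Nat.add_sub_cancel, Nat.add_sub_cancel, Finset.prod_Icc_succ_top (by omega)]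
  have hw := sum_birthWeight hdist (show 1 ≤ n + 1 by omega)
  rw [if_neg (by omega)] at hw
  -- The extra index `m = n + 1` is free: its factor `λ_{n+1} - λ_m` is zero. Both levels can now be
  -- compared term by term.
  have hext : ∑ m ∈ Finset.Icc 1 n, birthWeight lam n m *
        rlIntegral ν (fun s => mittagLeffler ν (-lam m * s ^ ν)) t =
      ∑ m ∈ Finset.Icc 1 (n + 1), (lam (n + 1) - lam m) * birthWeight lam (n + 1) m *
        rlIntegral ν (fun s => mittagLeffler ν (-lam m * s ^ ν)) t := by
    rw [Finset.sum_Icc_succ_top (by omega), sub_self, zero_mul, zero_mul, add_zero]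
    exact Finset.sum_congr rfl fun m hm => by rw [birthWeight_eq_mul_succ hdist hm]
  rw [hI, hI, hext, hprod, birthSolution, hprod]
  -- The coefficient `-λ_m` from the Mittag-Leffler equation is split as `-λ_{n+1} + (λ_{n+1} -
  -- λ_m)`: the first part is the death term, the second the inflow from level `n`.
  have hsum : ∑ m ∈ Finset.Icc 1 (n + 1), birthWeight lam (n + 1) m *
        mittagLeffler ν (-lam m * t ^ ν) =
      ∑ m ∈ Finset.Icc 1 (n + 1), (-lam (n + 1) * (birthWeight lam (n + 1) m *
        rlIntegral ν (fun s => mittagLeffler ν (-lam m * s ^ ν)) t) +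
        (lam (n + 1) - lam m) * birthWeight lam (n + 1) m *
        rlIntegral ν (fun s => mittagLeffler ν (-lam m * s ^ ν)) t) +
      ∑ m ∈ Finset.Icc 1 (n + 1), birthWeight lam (n + 1) m := by
    rw [← Finset.sum_add_distrib]
    refine Finset.sum_congr rfl fun m _ => ?_
    rw [mittagLeffler_eq_one_add_rlIntegral hν ht]
    ring
  rw [hsum, hw, Finset.sum_add_distrib, ← Finset.mul_sum]
  ring

section Processes

variable {Ω : Type*} [MeasurableSpace Ω] {P : Measure Ω}

theorem stateProb_eq_max (N : ℝ≥0 → Ω → ℕ) (n : ℕ) (s : ℝ) :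
    stateProb P N n s = stateProb P N n (max s 0) := by
  rw [stateProb, stateProb, Real.toNNReal_of_nonneg (le_max_right s 0)]
  rfl

theorem IsFractionalBirthProcess.continuous_stateProb {ν : ℝ} {lam : ℕ → ℝ} {N : ℝ≥0 → Ω → ℕ}
    (h : IsFractionalBirthProcess ν lam P N) {n : ℕ} (hn : 1 ≤ n) :
    Continuous (stateProb P N n) := by
  have hon : ContinuousOn (stateProb P N n) (Ici 0) := fun s hs => by
    have hs' : 0 < s + 1 := by linarith [mem_Ici.1 hs]
    have := (h.abs_cont n hn (s + 1) hs').continuousOn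
    rw [uIcc_of_le hs'.le] at this
    refine (this s ⟨hs, by linarith⟩).mono_of_mem_nhdsWithin ?_
    rw [← Ici_inter_Iic]
    exact inter_mem_nhdsWithin _ (Iic_mem_nhds (by linarith))
  have := hon.comp_continuous (continuous_id.max continuous_const) fun s => le_max_right s 0
  exact this.congr fun s => (stateProb_eq_max N n s).symm

/-- By induction on `n`: once level `n - 1` is identified, the inflow terms cancel in the difference
of the two Volterra equations, and the difference solves a homogeneous one. -/
theorem IsFractionalBirthProcess.stateProb_eq [IsProbabilityMeasure P] {ν : ℝ} (hν : 0 < ν)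
    (hν1 : ν ≤ 1) {lam : ℕ → ℝ} (hdist : Set.InjOn lam (Set.Ici 1)) {N : ℝ≥0 → Ω → ℕ}
    (h : IsFractionalBirthProcess ν lam P N) {n : ℕ} (hn : 1 ≤ n) :
    ∀ s : ℝ, 0 ≤ s → stateProb P N n s = birthSolution ν lam n s := by
  have hzero : stateProb P N 0 = fun _ => 0 := by
    ext s
    rw [stateProb_eq_max]
    exact h.prob_zero _ (le_max_right _ _)
  have hcont : ∀ n, Continuous (stateProb P N n) := fun n => by
    rcases Nat.eq_zero_or_pos n with rfl | hn
    · rw [hzero]; exact continuous_const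
    · exact h.continuous_stateProb hn
  have hvol : ∀ n, 1 ≤ n → ∀ s : ℝ, 0 ≤ s → stateProb P N n s = (if n = 1 then 1 else 0) +
      (-lam n * rlIntegral ν (stateProb P N n) s +
        lam (n - 1) * rlIntegral ν (stateProb P N (n - 1)) s) := fun n hn s hs => by
    rw [← rlIntegral_linear hν (hcont n) (hcont (n - 1)), ← sub_eq_rlIntegral_of_caputoDeriv hν hν1
      (h.abs_cont n hn) (h.evolution n hn) hs, h.initial n hn]
    ring
  have huniq : ∀ n, 1 ≤ n → (∀ s : ℝ, 0 ≤ s → stateProb P N n s - birthSolution ν lam n s =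
      -lam n * (rlIntegral ν (stateProb P N n) s - rlIntegral ν (birthSolution ν lam n) s)) →
      ∀ s : ℝ, 0 ≤ s → stateProb P N n s = birthSolution ν lam n s := by
    intro n hn hd s hs
    have hc : Continuous fun s => 1 * stateProb P N n s + (-1) * birthSolution ν lam n s :=
      ((hcont n).const_mul _).add ((continuous_birthSolution hν lam n).const_mul _)
    obtain ⟨D, hD⟩ := (isCompact_Icc (a := (0 : ℝ)) (b := s)).exists_bound_of_continuousOn
      hc.continuousOn
    have h0 := eq_zero_of_eq_const_mul_rlIntegral hν (c := -lam n) hD (fun u hu => by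
      rw [rlIntegral_linear hν (hcont n) (continuous_birthSolution hν lam n)]
      linarith [hd u hu.1]) s ⟨hs, le_rfl⟩
    linarith
  induction n, hn using Nat.le_induction with
  | base =>
    refine huniq 1 le_rfl fun s hs => ?_
    rw [hvol 1 le_rfl s hs, birthSolution_one_eq hν hs]
    have : rlIntegral ν (stateProb P N (1 - 1)) s = 0 := by
      simp [hzero, rlIntegral]
    rw [this, if_pos rfl]
    ring
  | succ n hn ih =>
    refine huniq (n + 1) (by omega) fun s hs => ?_
    rw [hvol (n + 1) (by omega) s hs, birthSolution_succ_eq hν hs hdist hn, if_neg (by omega),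
      Nat.add_sub_cancel, rlIntegral_congr hs ih]
    ring

end Processes

/-! ### Integration against the truncated exponential density -/

theorem integral_exp_mul_rpow {β t a : ℝ} (hβ : 0 < β) (ht : 0 ≤ t) :
    ∫ s in (0 : ℝ)..t, β * Real.exp (-(β * s)) * s ^ a =
      (β ^ a)⁻¹ * lowerGamma (a + 1) (β * t) := by
  have h := intervalIntegral.integral_comp_mul_left (a := 0) (b := t)
    (fun u : ℝ => Real.exp (-u) * u ^ a) hβ.ne'
  rw [mul_zero, smul_eq_mul, eq_inv_mul_iff_mul_eq₀ hβ.ne'] at h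
  rw [lowerGamma, add_sub_cancel_right, ← h, ← intervalIntegral.integral_const_mul,
    ← intervalIntegral.integral_const_mul]
  refine intervalIntegral.integral_congr fun s hs => ?_
  rw [uIcc_of_le ht] at hs
  have := (Real.rpow_pos_of_pos hβ a).ne'
  rw [Real.mul_rpow hβ.le hs.1]
  field_simp

theorem integral_exp_mul_mittagLeffler {β ν t : ℝ} (hβ : 0 < β) (hν : 0 < ν) (ht : 0 ≤ t)
    (c : ℝ) :
    ∫ s in (0 : ℝ)..t, β * Real.exp (-(β * s)) * mittagLeffler ν (c * s ^ ν) =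
      ∑' r : ℕ, lowerGamma (ν * r + 1) (β * t) / Real.Gamma (ν * r + 1) * (c / β ^ ν) ^ r := by
  have hk : Continuous fun s : ℝ => β * Real.exp (-(β * s)) := by fun_prop
  have h := hasSum_intervalIntegral_mul_pow (summable_div_Gamma hν) ht
    (hk.intervalIntegrable 0 t) (continuous_const_mul_rpow hν c)
  rw [show (∫ s in (0 : ℝ)..t, β * Real.exp (-(β * s)) * mittagLeffler ν (c * s ^ ν)) = _
    from h.tsum_eq.symm]
  refine tsum_congr fun r => ?_
  have h1 : ∫ s in (0 : ℝ)..t, β * Real.exp (-(β * s)) *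
      ((Real.Gamma (ν * r + 1))⁻¹ * (c * s ^ ν) ^ r) =
      ((Real.Gamma (ν * r + 1))⁻¹ * c ^ r) *
        ∫ s in (0 : ℝ)..t, β * Real.exp (-(β * s)) * s ^ (ν * r) := by
    rw [← intervalIntegral.integral_const_mul]
    refine intervalIntegral.integral_congr fun s hs => ?_
    rw [uIcc_of_le ht] at hs
    rw [Real.rpow_mul hs.1, Real.rpow_natCast, mul_pow]
    ring
  rw [h1, integral_exp_mul_rpow hβ ht, Real.rpow_mul hβ.le, Real.rpow_natCast, div_pow]
  ring

theorem integral_exp_mul_birthSolution {β ν t : ℝ} (hβ : 0 < β) (hν : 0 < ν) (ht : 0 ≤ t)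
    (lam : ℕ → ℝ) (n : ℕ) :
    ∫ s in (0 : ℝ)..t, β * Real.exp (-(β * s)) * birthSolution ν lam n s =
      (∏ h ∈ Finset.Icc 1 (n - 1), lam h) * ∑ m ∈ Finset.Icc 1 n, birthWeight lam n m *
        ∑' r : ℕ, lowerGamma (ν * r + 1) (β * t) / Real.Gamma (ν * r + 1) *
          (-lam m / β ^ ν) ^ r := by
  simp_rw [← integral_exp_mul_mittagLeffler hβ hν ht,
    ← intervalIntegral.integral_const_mul (a := (0 : ℝ)) (b := t)]
  rw [← intervalIntegral.integral_finsetSum, ← intervalIntegral.integral_const_mul]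
  · congr 1 with s
    rw [birthSolution, Finset.mul_sum, Finset.mul_sum, Finset.mul_sum]
    exact Finset.sum_congr rfl fun i _ => by ring
  · exact fun m _ => Continuous.intervalIntegrable
      (((by fun_prop : Continuous fun s : ℝ => β * Real.exp (-(β * s))).mul
        (continuous_mittagLeffler_comp hν (-lam m))).const_mul _) _ _

/-! ### Adding an independent exponential waiting time -/

section Exponential

variable {Ω : Type*} [MeasurableSpace Ω] {P : Measure Ω}

theorem lintegral_expMeasure {c : ℝ} {h : ℝ → ℝ≥0∞} (hh : Measurable h) :
    ∫⁻ x, h x ∂(expMeasure c) =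
      ∫⁻ x in Ioi (0 : ℝ), ENNReal.ofReal (c * Real.exp (-(c * x))) * h x := by
  have h1 : expMeasure c = volume.withDensity (exponentialPDF c) := rfl
  have hm : Measurable (exponentialPDF c) := by
    unfold exponentialPDF
    fun_prop
  rw [h1, lintegral_withDensity_eq_lintegral_mul _ hm hh, ← lintegral_indicator measurableSet_Ioi]
  refine lintegral_congr_ae ?_
  filter_upwards [compl_mem_ae_iff.2 (measure_singleton (0 : ℝ))] with x hx
  rcases lt_or_gt_of_ne (show x ≠ 0 from hx) with hx | hx
  · simp [exponentialPDF_of_neg hx, indicator, hx.not_gt]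
  · simp [exponentialPDF_of_nonneg hx.le, indicator, hx]

theorem expMeasure_Ioi {c x : ℝ} (hc : 0 < c) (hx : 0 ≤ x) :
    expMeasure c (Ioi x) = ENNReal.ofReal (Real.exp (-(c * x))) := by
  have := isProbabilityMeasure_expMeasure hc
  have h := cdf_expMeasure_eq hc x
  rw [if_pos hx, cdf_eq_real] at h
  rw [← compl_Iic, prob_compl_eq_one_sub measurableSet_Iic, ← ofReal_measureReal, h,
    ← ENNReal.ofReal_one, ← ENNReal.ofReal_sub _ (by simp; positivity)]
  simp

/-- Integration of a function of two independent variables, the second one exponential. -/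
theorem lintegral_mul_indep_eq [IsProbabilityMeasure P] {F : Ω → ℝ≥0∞} {X Y : Ω → ℝ}
    (hF : Measurable F) (hX : Measurable X) (hY : Measurable Y) {μ : Measure ℝ}
    [IsProbabilityMeasure μ] (hlaw : HasLaw Y μ P)
    (hind : IndepFun (fun ω => (F ω, X ω)) Y P) {U : ℝ → ℝ≥0∞}
    (hU : ∀ h : ℝ → ℝ≥0∞, Measurable h →
      ∫⁻ ω, F ω * h (X ω) ∂P = ∫⁻ s in Ioi (0 : ℝ), h s * U s)
    {g : ℝ → ℝ → ℝ≥0∞} (hg : Measurable (Function.uncurry g)) :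
    ∫⁻ ω, F ω * g (X ω) (Y ω) ∂P = ∫⁻ s in Ioi (0 : ℝ), (∫⁻ y, g s y ∂μ) * U s := by
  have hZ : Measurable fun ω => (F ω, X ω) := hF.prodMk hX
  have hprod := (indepFun_iff_map_prod_eq_prod_map_map hZ.aemeasurable hY.aemeasurable).1 hind
  rw [hlaw.map_eq] at hprod
  have hGm : Measurable fun p : (ℝ≥0∞ × ℝ) × ℝ => p.1.1 * g p.1.2 p.2 :=
    (measurable_fst.comp measurable_fst).mul
      (hg.comp ((measurable_snd.comp measurable_fst).prodMk measurable_snd))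
  have h1 : ∫⁻ ω, F ω * g (X ω) (Y ω) ∂P =
      ∫⁻ p, p.1.1 * g p.1.2 p.2 ∂(P.map fun ω => ((F ω, X ω), Y ω)) := by
    rw [lintegral_map hGm (hZ.prodMk hY)]
  have hHm : Measurable fun s => ∫⁻ y, g s y ∂μ := hg.lintegral_prod_right'
  rw [h1, hprod, lintegral_prod _ hGm.aemeasurable, lintegral_map hGm.lintegral_prod_right' hZ,
    ← hU _ hHm]
  refine lintegral_congr fun ω => ?_
  rw [lintegral_const_mul]
  exact hg.comp (measurable_const.prodMk measurable_id)

/-- The product `e^{-c(y-s)} e^{-cs}` does not depend on `s`, so the convolution collapses to `∫ V'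
= V`. -/
theorem lintegral_convolution_exp {c y : ℝ} (hy : 0 ≤ y) {V V' : ℝ → ℝ}
    (hV0 : V 0 = 0) (hV : ∀ s, HasDerivAt V (V' s) s) (hV' : Continuous V')
    (hnn : ∀ s, 0 ≤ s → 0 ≤ V' s) :
    ∫⁻ s in Ioo 0 y, ENNReal.ofReal (Real.exp (-(c * (y - s)))) *
        ENNReal.ofReal (Real.exp (-(c * s)) * V' s) =
      ENNReal.ofReal (Real.exp (-(c * y)) * V y) := by
  have h1 : ∫ s in (0 : ℝ)..y, V' s = V y := by
    rw [intervalIntegral.integral_eq_sub_of_hasDerivAt (fun s _ => hV s)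
      (hV'.intervalIntegrable _ _), hV0, sub_zero]
  rw [restrict_Ioo_eq_restrict_Ioc, ← h1, ← intervalIntegral.integral_const_mul, intervalIntegral.integral_of_le hy,
    ofReal_integral_eq_lintegral_ofReal]
  · refine setLIntegral_congr_fun measurableSet_Ioc fun s _ => ?_
    rw [← ENNReal.ofReal_mul (Real.exp_nonneg _), ← mul_assoc, ← Real.exp_add]
    ring_nf
  · exact ((hV'.const_mul _).intervalIntegrable 0 y).1
  · filter_upwards [ae_restrict_mem measurableSet_Ioc] with s hs
    exact mul_nonneg (Real.exp_nonneg _) (hnn s hs.1.le)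

/-- The renewal step. `hU` says that `X` has density `e^{-cs} V'(s) / c` under the weight `F`; in
this normalization, adding `Y` just integrates `V'`. Tonelli and the collapsed convolution give the
result. -/
theorem lintegral_mul_comp_add_exp [IsProbabilityMeasure P] {F : Ω → ℝ≥0∞} {X Y : Ω → ℝ}
    (hF : Measurable F) (hX : Measurable X) (hY : Measurable Y) {c : ℝ} (hc : 0 < c)
    (hlaw : HasLaw Y (expMeasure c) P) (hind : IndepFun (fun ω => (F ω, X ω)) Y P)
    {V V' : ℝ → ℝ} (hV0 : V 0 = 0) (hV : ∀ s, HasDerivAt V (V' s) s) (hV' : Continuous V')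
    (hnn : ∀ s, 0 ≤ s → 0 ≤ V' s)
    (hU : ∀ h : ℝ → ℝ≥0∞, Measurable h → ∫⁻ ω, F ω * h (X ω) ∂P =
      ∫⁻ s in Ioi (0 : ℝ), h s * ENNReal.ofReal (Real.exp (-(c * s)) * V' s / c))
    {h : ℝ → ℝ≥0∞} (hh : Measurable h) :
    ∫⁻ ω, F ω * h (X ω + Y ω) ∂P =
      ∫⁻ s in Ioi (0 : ℝ), h s * ENNReal.ofReal (Real.exp (-(c * s)) * V s) := by
  have := isProbabilityMeasure_expMeasure hc
  have hUm : Measurable fun s => ENNReal.ofReal (Real.exp (-(c * s)) * V' s / c) := by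
    fun_prop
  rw [lintegral_mul_indep_eq hF hX hY hlaw hind hU (g := fun s y => h (s + y))
    (hh.comp (measurable_fst.add measurable_snd))]
  have h1 : ∀ s, ∫⁻ y, h (s + y) ∂(expMeasure c) =
      ∫⁻ y in Ioi s, ENNReal.ofReal (c * Real.exp (-(c * (y - s)))) * h y := fun s => by
    rw [lintegral_expMeasure (h := fun y => h (s + y)) (by fun_prop)]
    have := (measurePreserving_add_left volume s).setLIntegral_comp_preimage
      (s := Ioi s) measurableSet_Ioi
      (f := fun y => ENNReal.ofReal (c * Real.exp (-(c * (y - s)))) * h y) (by fun_prop)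
    rw [← this]
    simp
  set K : ℝ → ℝ → ℝ≥0∞ := fun s y => {p : ℝ × ℝ | p.1 < p.2}.indicator (fun p =>
    ENNReal.ofReal (Real.exp (-(c * (p.2 - p.1)))) *
      ENNReal.ofReal (Real.exp (-(c * p.1)) * V' p.1) * h p.2) (s, y) with hK
  have hKm : Measurable (Function.uncurry K) := by
    refine Measurable.indicator ?_ (measurableSet_lt measurable_fst measurable_snd)
    fun_prop
  have hleft : ∀ s ∈ Ioi (0 : ℝ), (∫⁻ y, h (s + y) ∂(expMeasure c)) *
      ENNReal.ofReal (Real.exp (-(c * s)) * V' s / c) = ∫⁻ y in Ioi (0 : ℝ), K s y := by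
    intro s hs
    have hKs : K s = (Ioi s).indicator fun y => ENNReal.ofReal (Real.exp (-(c * (y - s)))) *
        ENNReal.ofReal (Real.exp (-(c * s)) * V' s) * h y := by
      ext y
      simp [hK, indicator]
    rw [hKs, setLIntegral_indicator measurableSet_Ioi,
      inter_eq_left.2 (Ioi_subset_Ioi (le_of_lt hs)), h1, ← lintegral_mul_const _ (by fun_prop)]
    refine lintegral_congr fun y => ?_
    rw [mul_right_comm, ← ENNReal.ofReal_mul (by positivity),
      ← ENNReal.ofReal_mul (Real.exp_nonneg _)]
    congr 2
    field_simp
  have hright : ∀ y ∈ Ioi (0 : ℝ), h y * ENNReal.ofReal (Real.exp (-(c * y)) * V y) =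
      ∫⁻ s in Ioi (0 : ℝ), K s y := by
    intro y hy
    have hKy : (fun s => K s y) = (Iio y).indicator fun s =>
        ENNReal.ofReal (Real.exp (-(c * (y - s)))) *
        ENNReal.ofReal (Real.exp (-(c * s)) * V' s) * h y := by
      ext s
      simp [hK, indicator]
    rw [hKy, setLIntegral_indicator measurableSet_Iio, inter_comm, Ioi_inter_Iio,
      lintegral_mul_const _ (by fun_prop),
      lintegral_convolution_exp (le_of_lt hy) hV0 hV hV' hnn, mul_comm]
  rw [setLIntegral_congr_fun measurableSet_Ioi hleft,
    setLIntegral_congr_fun measurableSet_Ioi hright,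
    lintegral_lintegral_swap hKm.aemeasurable]

/-- Given `X = s ≤ t`, the event `t < X + Y` has probability `e^{-c(t-s)}`, and the same collapse
applies. -/
theorem lintegral_mul_indicator_survival [IsProbabilityMeasure P] {F : Ω → ℝ≥0∞} {X Y : Ω → ℝ}
    (hF : Measurable F) (hX : Measurable X) (hY : Measurable Y) {c t : ℝ} (hc : 0 < c)
    (ht : 0 ≤ t)
    (hlaw : HasLaw Y (expMeasure c) P) (hind : IndepFun (fun ω => (F ω, X ω)) Y P)
    {V V' : ℝ → ℝ} (hV0 : V 0 = 0) (hV : ∀ s, HasDerivAt V (V' s) s) (hV' : Continuous V')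
    (hnn : ∀ s, 0 ≤ s → 0 ≤ V' s)
    (hU : ∀ h : ℝ → ℝ≥0∞, Measurable h → ∫⁻ ω, F ω * h (X ω) ∂P =
      ∫⁻ s in Ioi (0 : ℝ), h s * ENNReal.ofReal (Real.exp (-(c * s)) * V' s / c)) :
    ∫⁻ ω, F ω * {ω | X ω ≤ t ∧ t < X ω + Y ω}.indicator 1 ω ∂P =
      ENNReal.ofReal (Real.exp (-(c * t)) * V t / c) := by
  have := isProbabilityMeasure_expMeasure hc
  set A : Set (ℝ × ℝ) := {p | p.1 ≤ t ∧ t < p.1 + p.2}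
  have hA : MeasurableSet A := (measurableSet_le measurable_fst measurable_const).inter
    (measurableSet_lt measurable_const (measurable_fst.add measurable_snd))
  have h1 := lintegral_mul_indep_eq hF hX hY hlaw hind hU (g := fun s y => A.indicator 1 (s, y))
    (measurable_one.indicator hA)
  have h2 : ∀ s ∈ Ioi (0 : ℝ), (∫⁻ y, A.indicator (1 : ℝ × ℝ → ℝ≥0∞) (s, y) ∂(expMeasure c)) *
      ENNReal.ofReal (Real.exp (-(c * s)) * V' s / c) = (Iic t).indicator (fun s =>
        ENNReal.ofReal (Real.exp (-(c * (t - s)))) *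
          ENNReal.ofReal (Real.exp (-(c * s)) * (V' s / c))) s := by
    intro s _
    by_cases hst : s ≤ t
    · have : (fun y => A.indicator (1 : ℝ × ℝ → ℝ≥0∞) (s, y)) = (Ioi (t - s)).indicator 1 := by
        ext y
        simp [A, indicator, hst, sub_lt_iff_lt_add']
      rw [this, lintegral_indicator_one measurableSet_Ioi, expMeasure_Ioi hc (sub_nonneg.2 hst),
        indicator_of_mem (show s ∈ Iic t from hst), mul_div_assoc]
    · simp [A, hst]
  have h3 := lintegral_convolution_exp (c := c) ht (V := fun s => V s / c)
    (V' := fun s => V' s / c) (by simp [hV0]) (fun s => (hV s).div_const c) (hV'.div_const c)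
    fun s hs => div_nonneg (hnn s hs) hc.le
  rw [setLIntegral_congr_fun measurableSet_Ioi h2, setLIntegral_indicator measurableSet_Iic,
    inter_comm, Ioi_inter_Iic, ← restrict_Ioo_eq_restrict_Ioc, h3, ← mul_div_assoc] at h1
  rw [← h1]
  rfl

end Exponential

/-! ### Creation times in the Yule process -/

theorem creationTime_succ {Ω : Type*} (τ : ℕ → Ω → ℝ) (k : ℕ) (ω : Ω) :
    creationTime τ (k + 1) ω = creationTime τ k ω + τ k ω :=
  Finset.sum_range_succ _ _

section YuleTimes

variable {Ω : Type*} [MeasurableSpace Ω] {P : Measure Ω}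

theorem measurable_creationTime {τ : ℕ → Ω → ℝ} (hτ : ∀ j, Measurable (τ j)) (k : ℕ) :
    Measurable (creationTime τ k) :=
  Finset.measurable_fun_sum _ fun j _ => hτ j

/-- The event that exactly `k + 1` webpages have been created in `(0, t]`. -/
def pagesEvent (τ : ℕ → Ω → ℝ) (t : ℝ) (k : ℕ) : Set Ω :=
  {ω | creationTime τ (k + 1) ω ≤ t ∧ t < creationTime τ (k + 2) ω}

theorem measurableSet_pagesEvent {τ : ℕ → Ω → ℝ} (hτ : ∀ j, Measurable (τ j)) (t : ℝ) (k : ℕ) :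
    MeasurableSet (pagesEvent τ t k) :=
  (measurableSet_le (measurable_creationTime hτ _) measurable_const).inter
    (measurableSet_lt measurable_const (measurable_creationTime hτ _))

/-- The sum of `φ` over the creation times of the webpages `1, …, k + 1`. -/
noncomputable def pageSum (τ : ℕ → Ω → ℝ) (φ : ℝ → ℝ) (k : ℕ) (ω : Ω) : ℝ≥0∞ :=
  ∑ j ∈ Finset.Icc 1 (k + 1), ENNReal.ofReal (φ (creationTime τ j ω))

theorem measurable_pageSum {τ : ℕ → Ω → ℝ} (hτ : ∀ j, Measurable (τ j)) {φ : ℝ → ℝ}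
    (hφ : Measurable φ) (k : ℕ) : Measurable (pageSum τ φ k) :=
  Finset.measurable_fun_sum _ fun j _ => (hφ.comp (measurable_creationTime hτ j)).ennreal_ofReal

theorem indepFun_pageSum_creationTime {τ : ℕ → Ω → ℝ} (hτ : ∀ j, Measurable (τ j))
    (hind : iIndepFun τ P) {φ : ℝ → ℝ} (hφ : Measurable φ) (k : ℕ) :
    IndepFun (fun ω => (pageSum τ φ k ω, creationTime τ (k + 1) ω)) (τ (k + 1)) P := by
  have h := hind.indepFun_finset (Finset.range (k + 1)) {k + 1} (by simp) hτ
  -- `pageSum` and `creationTime` expect infinite sequences; padding with zeros makes them functions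
  -- of the first `k + 1` waiting times alone, which are independent of the next one.
  set pad : (Finset.range (k + 1) → ℝ) → ℕ → ℝ := fun v i =>
    if hi : i ∈ Finset.range (k + 1) then v ⟨i, hi⟩ else 0 with hpad
  have hpadm : ∀ i, Measurable fun v => pad v i := fun i => by
    by_cases hi : i ∈ Finset.range (k + 1)
    · simp only [hpad, hi, dite_true]
      exact measurable_pi_apply _
    · simp only [hpad, hi, dite_false]
      exact measurable_const
  have hcr : ∀ j ≤ k + 1, ∀ ω, creationTime τ j ω = creationTime (fun i v => pad v i) j
      (fun i : Finset.range (k + 1) => τ i ω) := fun j hj ω => by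
    refine Finset.sum_congr rfl fun i hi => ?_
    have : i ∈ Finset.range (k + 1) := Finset.mem_range.2 ((Finset.mem_range.1 hi).trans_le hj)
    simp only [hpad, this, dite_true]
  have hψ : Measurable fun v : ({k + 1} : Finset ℕ) → ℝ => v ⟨k + 1, by simp⟩ :=
    measurable_pi_apply _
  have h2 := h.comp (φ := fun v => (pageSum (fun i v => pad v i) φ k v,
    creationTime (fun i v => pad v i) (k + 1) v)) (ψ := fun v : ({k + 1} : Finset ℕ) → ℝ => v ⟨k + 1, by simp⟩)
    ((measurable_pageSum hpadm hφ k).prodMk (measurable_creationTime hpadm _))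
    hψ
  refine h2.congr (ae_of_all _ fun ω => ?_) (ae_of_all _ fun ω => rfl)
  simp only [Function.comp_apply, Prod.mk.injEq]
  refine ⟨Finset.sum_congr rfl fun j hj => ?_, (hcr _ le_rfl ω).symm⟩
  rw [hcr j (Finset.mem_Icc.1 hj).2]

theorem hasDerivAt_exp_sub_one_pow (β : ℝ) (k : ℕ) (s : ℝ) :
    HasDerivAt (fun s => (Real.exp (β * s) - 1) ^ k)
      (k * (Real.exp (β * s) - 1) ^ (k - 1) * (β * Real.exp (β * s))) s := by
  have h : HasDerivAt (fun s => Real.exp (β * s) - 1) (β * Real.exp (β * s)) s := by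
    have := (((hasDerivAt_id s).const_mul β).exp).sub_const 1
    simpa [mul_comm] using this
  exact h.pow k

theorem exp_sub_one_nonneg {β s : ℝ} (hβ : 0 < β) (hs : 0 ≤ s) : 0 ≤ Real.exp (β * s) - 1 := by
  have := Real.one_le_exp (mul_nonneg hβ.le hs)
  linarith

variable {β : ℝ} {τ : ℕ → Ω → ℝ}

theorem lintegral_time_zero (hτ : ∀ j, Measurable (τ j))
    (hlaw : ∀ j : ℕ, HasLaw (τ j) (expMeasure (β * ((j : ℝ) + 1))) P) {h : ℝ → ℝ≥0∞}
    (hh : Measurable h) : ∫⁻ ω, h (creationTime τ 1 ω) ∂P =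
      ∫⁻ s in Ioi (0 : ℝ), ENNReal.ofReal (β * Real.exp (-(β * s))) * h s := by
  have h0 := hlaw 0
  simp only [Nat.cast_zero, zero_add, mul_one] at h0
  rw [← lintegral_expMeasure hh, ← h0.map_eq, lintegral_map hh (hτ 0)]
  simp [creationTime]

variable [IsProbabilityMeasure P]

theorem lintegral_creationTime (hβ : 0 < β) (hτ : ∀ j, Measurable (τ j))
    (hlaw : ∀ j : ℕ, HasLaw (τ j) (expMeasure (β * ((j : ℝ) + 1))) P) (hind : iIndepFun τ P)
    (k : ℕ) {h : ℝ → ℝ≥0∞} (hh : Measurable h) :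
    ∫⁻ ω, h (creationTime τ (k + 1) ω) ∂P = ∫⁻ s in Ioi (0 : ℝ), h s *
      ENNReal.ofReal ((k + 1) * β * Real.exp (-(β * (k + 1) * s)) *
        (Real.exp (β * s) - 1) ^ k) := by
  induction k generalizing h with
  | zero =>
    rw [lintegral_time_zero hτ hlaw hh]
    refine lintegral_congr fun s => ?_
    rw [mul_comm]
    simp
  | succ k ih =>
    have hc : 0 < β * (((k + 1 : ℕ) : ℝ) + 1) := by positivity
    have hindep : IndepFun (fun ω => ((1 : ℝ≥0∞), creationTime τ (k + 1) ω)) (τ (k + 1)) P :=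
      (indepFun_pageSum_creationTime hτ hind measurable_const k (φ := fun _ => 1)).comp
        (φ := fun p : ℝ≥0∞ × ℝ => ((1 : ℝ≥0∞), p.2)) (by fun_prop)
        measurable_id
    have key := lintegral_mul_comp_add_exp (F := fun _ => 1) measurable_const
      (measurable_creationTime hτ (k + 1)) (hτ (k + 1)) hc (hlaw (k + 1)) hindep
      -- With `c = β (k + 2)`, this `V` makes `e^{-cs} V'(s) / c` the density of the preceding
      -- creation time.
      (V := fun s => β * (k + 2) * (Real.exp (β * s) - 1) ^ (k + 1)) (by simp)
      (fun s => (hasDerivAt_exp_sub_one_pow β (k + 1) s).const_mul _) (by fun_prop)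
      (fun s hs => by have := exp_sub_one_nonneg hβ hs; positivity)
      (fun h hh => by
        simp only [one_mul]
        rw [ih hh]
        refine lintegral_congr fun s => ?_
        congr 2
        have : Real.exp (-(β * (k + 1) * s)) =
            Real.exp (-(β * (((k + 1 : ℕ) : ℝ) + 1) * s)) * Real.exp (β * s) := by
          rw [← Real.exp_add]
          congr 1
          push_cast
          ring
        rw [this, eq_div_iff hc.ne']
        push_cast
        ring) hh
    simp only [one_mul] at key
    simp_rw [creationTime_succ τ (k + 1)]
    rw [key]
    refine lintegral_congr fun s => ?_
    congr 2
    push_cast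
    ring

/-- The integral of `φ u * β e^{β u}` over `[0, s]`. -/
noncomputable def expPrimitive (β : ℝ) (φ : ℝ → ℝ) (s : ℝ) : ℝ :=
  ∫ u in (0 : ℝ)..s, φ u * (β * Real.exp (β * u))

theorem hasDerivAt_expPrimitive {φ : ℝ → ℝ} (hφ : Continuous φ) (s : ℝ) :
    HasDerivAt (expPrimitive β φ) (φ s * (β * Real.exp (β * s))) s :=
  ((by fun_prop : Continuous fun u => φ u * (β * Real.exp (β * u))).integral_hasStrictDerivAt
    0 s).hasDerivAt

theorem continuous_expPrimitive {φ : ℝ → ℝ} (hφ : Continuous φ) :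
    Continuous (expPrimitive β φ) :=
  continuous_iff_continuousAt.2 fun s => (hasDerivAt_expPrimitive hφ s).continuousAt

theorem expPrimitive_nonneg (hβ : 0 < β) {φ : ℝ → ℝ} (hφ0 : ∀ s, 0 ≤ φ s) {s : ℝ} (hs : 0 ≤ s) :
    0 ≤ expPrimitive β φ s :=
  intervalIntegral.integral_nonneg hs fun u _ =>
    mul_nonneg (hφ0 u) (mul_nonneg hβ.le (Real.exp_nonneg _))

/-- `β (k+1) (k+2) (e^{β s} - 1)^k ∫₀ˢ φ(u) β e^{β u} du`. -/
noncomputable def pageSumAux (β : ℝ) (φ : ℝ → ℝ) (k : ℕ) (s : ℝ) : ℝ :=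
  β * (k + 1) * (k + 2) * ((Real.exp (β * s) - 1) ^ k * expPrimitive β φ s)

/-- The derivative of `pageSumAux`. -/
noncomputable def pageSumAuxDeriv (β : ℝ) (φ : ℝ → ℝ) (k : ℕ) (s : ℝ) : ℝ :=
  β * (k + 1) * (k + 2) * (k * (Real.exp (β * s) - 1) ^ (k - 1) * (β * Real.exp (β * s)) *
    expPrimitive β φ s + (Real.exp (β * s) - 1) ^ k * (φ s * (β * Real.exp (β * s))))

theorem hasDerivAt_pageSumAux {φ : ℝ → ℝ} (hφ : Continuous φ) (k : ℕ) (s : ℝ) :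
    HasDerivAt (pageSumAux β φ k) (pageSumAuxDeriv β φ k s) s :=
  ((hasDerivAt_exp_sub_one_pow β k s).mul (hasDerivAt_expPrimitive hφ s)).const_mul _

theorem continuous_pageSumAuxDeriv {φ : ℝ → ℝ} (hφ : Continuous φ) (k : ℕ) :
    Continuous (pageSumAuxDeriv β φ k) := by
  have := continuous_expPrimitive (β := β) hφ
  unfold pageSumAuxDeriv
  fun_prop

theorem pageSumAuxDeriv_nonneg (hβ : 0 < β) {φ : ℝ → ℝ} (hφ0 : ∀ s, 0 ≤ φ s) (k : ℕ) {s : ℝ}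
    (hs : 0 ≤ s) : 0 ≤ pageSumAuxDeriv β φ k s := by
  have h1 := exp_sub_one_nonneg hβ hs
  have h2 := expPrimitive_nonneg hβ hφ0 hs
  have h3 := hφ0 s
  unfold pageSumAuxDeriv
  positivity

theorem pageSumAux_zero (φ : ℝ → ℝ) (k : ℕ) : pageSumAux β φ k 0 = 0 := by
  simp [pageSumAux, expPrimitive]

/-- Heuristically, given that page `k + 1` appears at `s`, the `k` earlier times are order
statistics of independent variables with density proportional to `e^{βu}` on `[0, s]`; this predicts
`pageSumAuxDeriv`. The proof is by induction: the old terms advance by the renewal step, and the new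
term involves only the last creation time, whose density is known. -/
theorem lintegral_pageSum_mul_creationTime (hβ : 0 < β) (hτ : ∀ j, Measurable (τ j))
    (hlaw : ∀ j : ℕ, HasLaw (τ j) (expMeasure (β * ((j : ℝ) + 1))) P) (hind : iIndepFun τ P)
    {φ : ℝ → ℝ} (hφ : Continuous φ) (hφ0 : ∀ s, 0 ≤ φ s) (k : ℕ) {h : ℝ → ℝ≥0∞}
    (hh : Measurable h) :
    ∫⁻ ω, pageSum τ φ k ω * h (creationTime τ (k + 1) ω) ∂P = ∫⁻ s in Ioi (0 : ℝ), h s *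
      ENNReal.ofReal (Real.exp (-(β * (((k + 1 : ℕ) : ℝ) + 1) * s)) * pageSumAuxDeriv β φ k s /
        (β * (((k + 1 : ℕ) : ℝ) + 1))) := by
  have hφm : Measurable fun s => ENNReal.ofReal (φ s) := hφ.measurable.ennreal_ofReal
  induction k generalizing h with
  | zero =>
    have := lintegral_time_zero hτ hlaw (hφm.mul hh)
    simp only [Pi.mul_apply] at this
    simp only [pageSum, zero_add, Finset.Icc_self, Finset.sum_singleton]
    rw [this]
    refine lintegral_congr fun s => ?_
    rw [← mul_assoc, mul_comm, ← ENNReal.ofReal_mul (by positivity)]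
    congr 2
    have : Real.exp (-(β * s)) = Real.exp (-(β * (((1 : ℕ) : ℝ) + 1) * s)) * Real.exp (β * s) := by
      rw [← Real.exp_add]
      congr 1
      push_cast
      ring
    rw [this]
    simp only [pageSumAuxDeriv]
    norm_num
    field_simp
  | succ k ih =>
    have hc : 0 < β * (((k + 1 : ℕ) : ℝ) + 1) := by positivity
    have key := lintegral_mul_comp_add_exp (measurable_pageSum hτ hφ.measurable k)
      (measurable_creationTime hτ (k + 1)) (hτ (k + 1)) hc (hlaw (k + 1))
      (indepFun_pageSum_creationTime hτ hind hφ.measurable k)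
      (pageSumAux_zero φ k) (hasDerivAt_pageSumAux hφ k) (continuous_pageSumAuxDeriv hφ k)
      (fun s hs => pageSumAuxDeriv_nonneg hβ hφ0 k hs) (fun h hh => ih hh) hh
    have hlast := lintegral_creationTime hβ hτ hlaw hind (k + 1) (hφm.mul hh)
    have hsplit : ∀ ω, pageSum τ φ (k + 1) ω * h (creationTime τ (k + 1 + 1) ω) =
        pageSum τ φ k ω * h (creationTime τ (k + 1) ω + τ (k + 1) ω) +
        ((fun s => ENNReal.ofReal (φ s)) * h) (creationTime τ (k + 1 + 1) ω) := fun ω => by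
      rw [pageSum, Finset.sum_Icc_succ_top (by omega), add_mul, creationTime_succ τ (k + 1)]
      rfl
    simp_rw [hsplit]
    have hT := measurable_creationTime hτ (k + 1 + 1)
    rw [lintegral_add_right (g := fun ω => ((fun s => ENNReal.ofReal (φ s)) * h)
      (creationTime τ (k + 1 + 1) ω)) _ ((hφm.mul hh).comp hT), key, hlast, ← lintegral_add_right]
    · refine setLIntegral_congr_fun measurableSet_Ioi fun s hs => ?_
      have hs : 0 ≤ s := le_of_lt hs
      have h1 := exp_sub_one_nonneg hβ hs
      have h2 := expPrimitive_nonneg hβ hφ0 hs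
      simp only [Pi.mul_apply]
      rw [mul_comm (ENNReal.ofReal (φ s)), mul_assoc (h s), ← mul_add,
        ← ENNReal.ofReal_mul (hφ0 s), ← ENNReal.ofReal_add]
      · congr 2
        have : Real.exp (-(β * (((k + 1 : ℕ) : ℝ) + 1) * s)) =
            Real.exp (-(β * (((k + 1 + 1 : ℕ) : ℝ) + 1) * s)) * Real.exp (β * s) := by
          rw [← Real.exp_add]
          congr 1
          push_cast
          ring
        rw [this]
        simp only [pageSumAux, pageSumAuxDeriv, Nat.add_sub_cancel]
        push_cast
        field_simp
        ring
      · rw [pageSumAux]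
        positivity
      · have := hφ0 s
        positivity
    · fun_prop

/-- The survival formula at `t`, followed by the reversal `s = t - u` from creation time to age. The
integral on the right is the same for all `k`; this is why the age law ignores the number of pages.
-/
theorem lintegral_pageSum_mul_indicator (hβ : 0 < β) (hτ : ∀ j, Measurable (τ j))
    (hlaw : ∀ j : ℕ, HasLaw (τ j) (expMeasure (β * ((j : ℝ) + 1))) P) (hind : iIndepFun τ P)
    {t : ℝ} (ht : 0 ≤ t) {g : ℝ → ℝ} (hg : Continuous g) (hg0 : ∀ s, 0 ≤ g s) (k : ℕ) :
    ∫⁻ ω, pageSum τ (fun u => g (t - u)) k ω *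
      (pagesEvent τ t k).indicator 1 ω ∂P =
      ENNReal.ofReal ((k + 1) * (Real.exp (-(β * t)) * (1 - Real.exp (-(β * t))) ^ k *
        ∫ s in (0 : ℝ)..t, β * Real.exp (-(β * s)) * g s)) := by
  have hφ : Continuous fun u => g (t - u) := by fun_prop
  have hφ0 : ∀ u, 0 ≤ g (t - u) := fun u => hg0 _
  have hc : 0 < β * (((k + 1 : ℕ) : ℝ) + 1) := by positivity
  have key := lintegral_mul_indicator_survival (measurable_pageSum hτ hφ.measurable k)
    (measurable_creationTime hτ (k + 1)) (hτ (k + 1)) hc ht (hlaw (k + 1))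
    (indepFun_pageSum_creationTime hτ hind hφ.measurable k)
    (pageSumAux_zero _ k) (hasDerivAt_pageSumAux hφ k) (continuous_pageSumAuxDeriv hφ k)
    (fun s hs => pageSumAuxDeriv_nonneg hβ hφ0 k hs)
    (fun h hh => lintegral_pageSum_mul_creationTime hβ hτ hlaw hind hφ hφ0 k hh)
  simp_rw [← creationTime_succ τ (k + 1)] at key
  rw [pagesEvent, key]
  congr 1
  have hΦ : expPrimitive β (fun u => g (t - u)) t =
      Real.exp (β * t) * ∫ s in (0 : ℝ)..t, β * Real.exp (-(β * s)) * g s := by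
    have := intervalIntegral.integral_comp_sub_left (a := 0) (b := t)
      (fun s => g s * (β * Real.exp (β * (t - s)))) t
    simp only [sub_self, sub_zero, sub_sub_cancel] at this
    rw [expPrimitive, this, ← intervalIntegral.integral_const_mul]
    congr 1 with s
    rw [mul_sub, sub_eq_add_neg, Real.exp_add]
    ring
  have hx : Real.exp (β * t) - 1 = Real.exp (β * t) * (1 - Real.exp (-(β * t))) := by
    rw [mul_sub, ← Real.exp_add]
    simp
  have hexp : Real.exp (-(β * (((k + 1 : ℕ) : ℝ) + 1) * t)) * Real.exp (β * t) ^ k *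
      Real.exp (β * t) = Real.exp (-(β * t)) := by
    rw [← Real.exp_nat_mul, ← Real.exp_add, ← Real.exp_add]
    congr 1
    push_cast
    ring
  rw [pageSumAux, hΦ, hx, mul_pow, ← hexp]
  push_cast
  field_simp
  ring

end YuleTimes

/-! ### A birth process observed at an independent random time -/

section RandomTime

open scoped Topology

/-- The approximation of `s` from the right by a point of the grid of mesh `1 / (m + 1)`. -/
noncomputable def gridApprox (m : ℕ) (s : ℝ≥0) : ℝ≥0 :=
  ((⌊(m + 1) * s⌋₊ : ℝ≥0) + 1) / (m + 1)

theorem le_gridApprox (m : ℕ) (s : ℝ≥0) : s ≤ gridApprox m s := by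
  rw [gridApprox, le_div_iff₀ (by positivity), mul_comm]
  exact (Nat.lt_floor_add_one _).le

theorem gridApprox_le (m : ℕ) (s : ℝ≥0) : gridApprox m s ≤ s + 1 / (m + 1) := by
  rw [gridApprox, div_le_iff₀ (by positivity), add_mul s,
    one_div_mul_cancel (by positivity), mul_comm s]
  gcongr
  exact Nat.floor_le (by positivity)

theorem tendsto_gridApprox (s : ℝ≥0) : Tendsto (fun m => gridApprox m s) atTop (𝓝[≥] s) := by
  refine tendsto_nhdsWithin_iff.2 ⟨?_, Eventually.of_forall fun m => le_gridApprox m s⟩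
  have h : Tendsto (fun m : ℕ => s + 1 / ((m : ℝ≥0) + 1)) atTop (𝓝 (s + 0)) :=
    tendsto_const_nhds.add tendsto_one_div_add_atTop_nhds_zero_nat
  rw [add_zero] at h
  exact tendsto_of_tendsto_of_tendsto_of_le_of_le tendsto_const_nhds h
    (fun m => le_gridApprox m s) fun m => gridApprox_le m s

theorem measurable_gridApprox (m : ℕ) : Measurable (gridApprox m) := by
  have h : Measurable fun s : ℝ≥0 => ((⌊(m + 1) * s⌋₊ : ℕ) : ℝ≥0) :=
    (measurable_of_countable (fun k : ℕ => (k : ℝ≥0))).comp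
      (Nat.measurable_floor.comp (measurable_id.const_mul _))
  exact (h.add_const 1).div_const _

variable {Ω : Type*} [MeasurableSpace Ω] {P : Measure Ω} [IsProbabilityMeasure P]
  {α : Type*} [MeasurableSpace α]

theorem measure_inter_gridApprox {N : ℝ≥0 → Ω → ℕ} (hN : ∀ s, Measurable (N s)) {Y : Ω → α}
    (hY : Measurable Y) (hind : IndepFun (fun ω s => N s ω) Y P) {S : α → ℝ≥0}
    (hS : Measurable S) {C : Set α} (hC : MeasurableSet C) (n m : ℕ) :
    MeasurableSet {ω | Y ω ∈ C ∧ N (gridApprox m (S (Y ω))) ω = n} ∧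
    P {ω | Y ω ∈ C ∧ N (gridApprox m (S (Y ω))) ω = n} =
      ∫⁻ ω in Y ⁻¹' C, P {ω' | N (gridApprox m (S (Y ω))) ω' = n} ∂P := by
  have hpath : Measurable fun ω s => N s ω := measurable_pi_iff.2 hN
  set D : Set ((ℝ≥0 → ℕ) × α) := {p | p.2 ∈ C ∧ p.1 (gridApprox m (S p.2)) = n} with hD
  have hDm : MeasurableSet D := by
    -- Evaluation of a path at a variable time is not measurable for the product σ-algebra, but a
    -- grid time takes countably many values, so `D` is a countable union of measurable sets.
    have : D = ⋃ i : ℕ, {p : (ℝ≥0 → ℕ) × α | (p.2 ∈ C ∧ ⌊(m + 1) * S p.2⌋₊ = i) ∧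
        p.1 (((i : ℝ≥0) + 1) / (m + 1)) = n} := by
      ext p
      simp [hD, gridApprox]
    rw [this]
    refine MeasurableSet.iUnion fun i => MeasurableSet.inter (MeasurableSet.inter
      (measurable_snd hC) ?_) ?_
    · exact (Nat.measurable_floor.comp ((hS.comp measurable_snd).const_mul _))
        (measurableSet_singleton i)
    · have : Measurable fun p : (ℝ≥0 → ℕ) × α => p.1 (((i : ℝ≥0) + 1) / (m + 1)) :=
        (measurable_pi_apply _).comp measurable_fst
      exact this (measurableSet_singleton n)
  refine ⟨(hpath.prodMk hY) hDm, ?_⟩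
  have hprod := (indepFun_iff_map_prod_eq_prod_map_map hpath.aemeasurable hY.aemeasurable).1 hind
  have hprob := Measure.isProbabilityMeasure_map (μ := P) hpath.aemeasurable
  have hprob' := Measure.isProbabilityMeasure_map (μ := P) hY.aemeasurable
  have h1 : P {ω | Y ω ∈ C ∧ N (gridApprox m (S (Y ω))) ω = n} =
      P.map (fun ω => ((fun s => N s ω), Y ω)) D := by
    rw [Measure.map_apply (hpath.prodMk hY) hDm]
    rfl
  rw [h1, hprod, Measure.prod_apply_symm hDm,
    lintegral_map (measurable_measure_prodMk_right hDm) hY, ← lintegral_indicator (hY hC)]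
  refine lintegral_congr fun ω => ?_
  rw [Measure.map_apply hpath (measurable_prodMk_right hDm)]
  by_cases h : Y ω ∈ C
  · rw [indicator_of_mem (show ω ∈ Y ⁻¹' C from h)]
    congr 1
    ext ω'
    simp [hD, h]
  · rw [indicator_of_notMem (show ω ∉ Y ⁻¹' C from h)]
    simp [hD, h]

/-- The paths are right-continuous and integer-valued, so along grid times decreasing to within `1 /
(m + 1)` of the random time the value is eventually the right one. The grid formula passes to the
limit, using continuity of the state probability and domination by `1`. -/
theorem measure_inter_randomTime {N : ℝ≥0 → Ω → ℕ} (hN : ∀ s, Measurable (N s))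
    (hright : ∀ ω s, ContinuousWithinAt (fun s => N s ω) (Ici s) s) {n : ℕ}
    (hcont : Continuous (stateProb P N n)) {Y : Ω → α}
    (hY : Measurable Y) (hind : IndepFun (fun ω s => N s ω) Y P) {S : α → ℝ}
    (hS : Measurable S) {C : Set α} (hC : MeasurableSet C) :
    MeasurableSet {ω | Y ω ∈ C ∧ N (S (Y ω)).toNNReal ω = n} ∧
    P {ω | Y ω ∈ C ∧ N (S (Y ω)).toNNReal ω = n} =
      ∫⁻ ω in Y ⁻¹' C, ENNReal.ofReal (stateProb P N n (S (Y ω))) ∂P := by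
  have hgrid := measure_inter_gridApprox hN hY hind hS.real_toNNReal hC n
  have hlim : ∀ ω, ∀ᶠ m in atTop,
      (ω ∈ {ω | Y ω ∈ C ∧ N (gridApprox m (S (Y ω)).toNNReal) ω = n} ↔
        ω ∈ {ω | Y ω ∈ C ∧ N (S (Y ω)).toNNReal ω = n}) := fun ω => by
    have h := (hright ω (S (Y ω)).toNNReal).tendsto.comp
      (tendsto_gridApprox (S (Y ω)).toNNReal)
    rw [nhds_discrete, tendsto_pure] at h
    filter_upwards [h] with m hm
    simp only [Function.comp_apply] at hm
    simp only [hm]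
  have hmeas : MeasurableSet {ω | Y ω ∈ C ∧ N (S (Y ω)).toNNReal ω = n} :=
    measurableSet_of_tendsto_indicator atTop (fun m => (hgrid m).1) hlim
  refine ⟨hmeas, ?_⟩
  have h1 := tendsto_measure_of_tendsto_indicator atTop (μ := P) (fun m => (hgrid m).1)
    (B := univ) MeasurableSet.univ (by simp) (by simp) hlim
  have hprob : ∀ s : ℝ≥0, P {ω | N s ω = n} = ENNReal.ofReal (stateProb P N n s) := fun s => by
    rw [stateProb, Real.toNNReal_coe, ofReal_measureReal]
  have hprob' : ∀ s : ℝ, P {ω | N s.toNNReal ω = n} = ENNReal.ofReal (stateProb P N n s) :=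
    fun s => by rw [stateProb, ofReal_measureReal]
  have hSY : Measurable fun ω => (S (Y ω)).toNNReal := (hS.comp hY).real_toNNReal
  have h2 : Tendsto (fun m => ∫⁻ ω in Y ⁻¹' C,
      P {ω' | N (gridApprox m (S (Y ω)).toNNReal) ω' = n} ∂P) atTop
      (𝓝 (∫⁻ ω in Y ⁻¹' C, ENNReal.ofReal (stateProb P N n (S (Y ω))) ∂P)) := by
    refine tendsto_lintegral_of_dominated_convergence (fun _ => 1) (fun m => ?_)
      (fun m => ae_of_all _ fun ω => prob_le_one) (by simp) (ae_of_all _ fun ω => ?_)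
    · simp_rw [hprob]
      exact (hcont.measurable.comp (measurable_coe_nnreal_real.comp
        ((measurable_gridApprox m).comp hSY))).ennreal_ofReal
    · simp_rw [← hprob', hprob]
      refine (ENNReal.continuous_ofReal.tendsto _).comp ((hcont.tendsto _).comp
        ((NNReal.continuous_coe.tendsto _).comp ?_))
      exact (tendsto_gridApprox _).mono_right nhdsWithin_le_nhds
  exact tendsto_nhds_unique h1 (h2.congr fun m => (hgrid m).2.symm)

end RandomTime

/-! ### Counting pages through creation times -/

section Counting

variable {Ω : Type*}

theorem creationTime_mono {τ : ℕ → Ω → ℝ} {ω : Ω} (h0 : ∀ j, 0 ≤ τ j ω) :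
    Monotone fun k => creationTime τ k ω :=
  monotone_nat_of_le_succ fun k => by
    rw [creationTime_succ]
    linarith [h0 k]

theorem newPages_eq_succ_iff {τ : ℕ → Ω → ℝ} {ω : Ω} (h0 : ∀ j, 0 ≤ τ j ω) (t : ℝ) (k : ℕ) :
    newPages τ t ω = k + 1 ↔ creationTime τ (k + 1) ω ≤ t ∧ t < creationTime τ (k + 2) ω := by
  have hmono := creationTime_mono h0
  set S : Set ℕ := {k : ℕ | 1 ≤ k ∧ creationTime τ k ω ≤ t} with hS
  have hcard : ∀ m : ℕ, (Icc 1 m).ncard = m := fun m => by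
    rw [← Finset.coe_Icc, Set.ncard_coe_finset, Nat.card_Icc, Nat.add_sub_cancel]
  have hlow : ∀ m, creationTime τ m ω ≤ t → Icc 1 m ⊆ S := fun m hm j hj =>
    ⟨hj.1, (hmono hj.2).trans hm⟩
  have hup : ∀ m, t < creationTime τ (m + 1) ω → S ⊆ Icc 1 m := fun m hm j hj =>
    ⟨hj.1, by
      by_contra hcon
      exact (hm.trans_le (hmono (show m + 1 ≤ j by omega))).not_ge hj.2⟩
  change S.ncard = k + 1 ↔ _
  constructor
  · intro h
    -- `ncard` is `0` on infinite sets, so the value `k + 1` forces finiteness.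
    have hfin : S.Finite := Set.finite_of_ncard_ne_zero (by omega)
    constructor
    · by_contra hcon
      have := Set.ncard_le_ncard (hup k (not_le.1 hcon)) (Set.finite_Icc 1 k)
      rw [hcard] at this
      omega
    · by_contra hcon
      have := Set.ncard_le_ncard (hlow (k + 2) (not_lt.1 hcon)) hfin
      rw [hcard] at this
      omega
  · rintro ⟨h1, h2⟩
    rw [(hup (k + 1) h2).antisymm (hlow (k + 1) h1), hcard]

end Counting

/-! ### The law of the chosen page's size -/

theorem hasSum_geometric_exp {β t : ℝ} (hβ : 0 < β) (ht : 0 < t) (I : ℝ) :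
    HasSum (fun k : ℕ => Real.exp (-(β * t)) * (1 - Real.exp (-(β * t))) ^ k * I) I := by
  have h1 : Real.exp (-(β * t)) < 1 := Real.exp_lt_one_iff.2 (neg_neg_of_pos (mul_pos hβ ht))
  have h2 := Real.exp_pos (-(β * t))
  have h := ((hasSum_geometric_of_lt_one (r := 1 - Real.exp (-(β * t))) (by linarith)
    (by linarith)).mul_left (Real.exp (-(β * t)))).mul_right I
  rwa [sub_sub_cancel, mul_inv_cancel₀ h2.ne', one_mul] at h

section Model

variable {Ω : Type*} [MeasurableSpace Ω] {P : Measure Ω}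
  {β ν t : ℝ} {lam : ℕ → ℝ} {τ : ℕ → Ω → ℝ} {N : ℕ → ℝ≥0 → Ω → ℕ} {J : ℕ → Ω → ℕ}

theorem IsGeneralizedYuleModel.ae_time_nonneg (h : IsGeneralizedYuleModel β ν lam P τ N J) :
    ∀ᵐ ω ∂P, ∀ j, 0 ≤ τ j ω := by
  refine ae_all_iff.2 fun j => ?_
  rw [(h.law_time j).ae_iff (p := fun x => 0 ≤ x) (measurableSet_setOfPred.1 measurableSet_Ici)]
  rw [ae_iff, ← lintegral_indicator_one (by simp only [not_le]; exact measurableSet_Iio),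
    lintegral_expMeasure (measurable_one.indicator (by simp only [not_le]; exact measurableSet_Iio))]
  refine (setLIntegral_congr_fun measurableSet_Ioi fun x hx => ?_).trans lintegral_zero
  have : 0 ≤ x := le_of_lt hx
  simp [this]

theorem IsGeneralizedYuleModel.ae_newPages_eq_iff (h : IsGeneralizedYuleModel β ν lam P τ N J) :
    ∀ᵐ ω ∂P, ∀ k, newPages τ t ω = k + 1 ↔ ω ∈ pagesEvent τ t k := by
  filter_upwards [h.ae_time_nonneg] with ω hω k using newPages_eq_succ_iff hω t k

theorem uniformOn_Icc_singleton {k j : ℕ} (hj : j ∈ Finset.Icc 1 (k + 1)) :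
    uniformOn (Icc 1 (k + 1)) ({j} : Set ℕ) = ENNReal.ofReal (1 / ((k : ℝ) + 1)) := by
  have := uniformOn_apply_finset (s := Finset.Icc 1 (k + 1)) (t := {j})
  rw [Finset.inter_singleton_of_mem hj, Finset.coe_Icc, Finset.coe_singleton] at this
  rw [this, ENNReal.ofReal_div_of_pos (by positivity)]
  simp only [Finset.card_singleton, Nat.card_Icc, Nat.add_sub_cancel, ENNReal.ofReal_one,
    Nat.cast_one]
  congr 1
  rw [← Nat.cast_succ, ENNReal.ofReal_natCast]

theorem IsGeneralizedYuleModel.ae_choice_mem (h : IsGeneralizedYuleModel β ν lam P τ N J) :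
    ∀ᵐ ω ∂P, ∀ k, J (k + 1) ω ∈ Finset.Icc 1 (k + 1) := by
  refine ae_all_iff.2 fun k => ?_
  rw [(h.law_choice (k + 1) (by omega)).ae_iff (p := fun x => x ∈ Finset.Icc 1 (k + 1))
    (measurableSet_setOfPred.1 (Finset.Icc 1 (k + 1)).measurableSet)]
  filter_upwards [ae_cond_mem (μ := Measure.count) (measurableSet_Icc (a := 1) (b := k + 1))]
    with x hx using Finset.mem_Icc.2 hx

variable [IsProbabilityMeasure P]

/-- The event that `k + 1` webpages have been created in `(0, t]`, and that webpage `j` is chosen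
and has `n` in-links at time `t`. -/
def choiceEvent (τ : ℕ → Ω → ℝ) (N : ℕ → ℝ≥0 → Ω → ℕ) (J : ℕ → Ω → ℕ) (t : ℝ) (n k j : ℕ) : Set Ω :=
  {ω | (ω ∈ pagesEvent τ t k ∧ J (k + 1) ω = j) ∧ N j (t - creationTime τ j ω).toNNReal ω = n}

/-- Independence is used twice: the process of page `j` is independent of times and choices, so its
value at its age contributes `p`; then the choice is independent of the times and contributes `1 /
(k + 1)`. -/
theorem IsGeneralizedYuleModel.measure_choiceEvent (h : IsGeneralizedYuleModel β ν lam P τ N J)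
    {n : ℕ} {p : ℝ → ℝ} (hp : ∀ j, stateProb P (N j) n = p) (hpc : Continuous p) {k j : ℕ}
    (hj : j ∈ Finset.Icc 1 (k + 1)) :
    MeasurableSet (choiceEvent τ N J t n k j) ∧
    P (choiceEvent τ N J t n k j) = ENNReal.ofReal (1 / ((k : ℝ) + 1)) *
      ∫⁻ ω, ENNReal.ofReal (p (t - creationTime τ j ω)) *
        (pagesEvent τ t k).indicator 1 ω ∂P := by
  have hcoord : ∀ i, Measurable fun v : ℕ → ℝ => v i := measurable_pi_apply
  have hcoord' : ∀ i, Measurable fun y : (ℕ → ℝ) × (ℕ → ℕ) => y.1 i := fun i =>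
    (measurable_pi_apply i).comp measurable_fst
  have hchoice : Measurable fun y : (ℕ → ℝ) × (ℕ → ℕ) => y.2 (k + 1) :=
    (measurable_pi_apply (k + 1)).comp measurable_snd
  have hY : Measurable fun ω => ((fun j : ℕ => τ j ω), (fun k : ℕ => J k ω)) :=
    (measurable_pi_iff.2 h.measurable_time).prodMk (measurable_pi_iff.2 h.measurable_choice)
  have hpath : Measurable fun (x : ℕ → ℝ≥0 → ℕ) => x j := measurable_pi_apply j
  have hind : IndepFun (fun ω s => N j s ω)
      (fun ω => ((fun j : ℕ => τ j ω), (fun k : ℕ => J k ω))) P :=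
    h.indep_birth_rest.comp hpath measurable_id
  have hC : MeasurableSet {y : (ℕ → ℝ) × (ℕ → ℕ) |
      y ∈ pagesEvent (fun i (y : (ℕ → ℝ) × (ℕ → ℕ)) => y.1 i) t k ∧ y.2 (k + 1) = j} :=
    (measurableSet_pagesEvent hcoord' t k).inter (hchoice (measurableSet_singleton j))
  obtain ⟨hm, hval⟩ := measure_inter_randomTime (n := n) (h.birth j).measurable
    (h.birth j).right_continuous (by rw [hp]; exact hpc) hY hind
    (S := fun y => t - creationTime (fun i (y : (ℕ → ℝ) × (ℕ → ℕ)) => y.1 i) j y)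
    (measurable_const.sub (measurable_creationTime hcoord' j)) hC
  refine ⟨hm, hval.trans ?_⟩
  set G : (ℕ → ℝ) → ℝ≥0∞ := fun v =>
    ENNReal.ofReal (p (t - creationTime (fun i (v : ℕ → ℝ) => v i) j v)) *
      (pagesEvent (fun i (v : ℕ → ℝ) => v i) t k).indicator 1 v with hG
  set H : (ℕ → ℕ) → ℝ≥0∞ := fun c => ({j} : Set ℕ).indicator 1 (c (k + 1)) with hH
  have hGm : Measurable G :=
    (hpc.measurable.comp (measurable_const.sub
      (measurable_creationTime hcoord j))).ennreal_ofReal.mul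
      (measurable_one.indicator (measurableSet_pagesEvent hcoord t k))
  have hHm : Measurable H :=
    (measurable_one.indicator (measurableSet_singleton j)).comp (measurable_pi_apply (k + 1))
  have hmul := lintegral_mul_eq_lintegral_mul_lintegral_of_indepFun''
    (hGm.comp (measurable_pi_iff.2 h.measurable_time)).aemeasurable
    (hHm.comp (measurable_pi_iff.2 h.measurable_choice)).aemeasurable
    (h.indep_time_choice.comp hGm hHm)
  have hHint : ∫⁻ ω, (H ∘ fun ω k => J k ω) ω ∂P = ENNReal.ofReal (1 / ((k : ℝ) + 1)) := by
    rw [← uniformOn_Icc_singleton hj, ← (h.law_choice (k + 1) (by omega)).map_eq,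
      Measure.map_apply (h.measurable_choice (k + 1)) (measurableSet_singleton j),
      ← lintegral_indicator_one (h.measurable_choice (k + 1) (measurableSet_singleton j))]
    rfl
  rw [hHint, mul_comm] at hmul
  refine Eq.trans ?_ hmul
  rw [← lintegral_indicator (hY hC)]
  refine lintegral_congr fun ω => ?_
  rw [hp]
  simp only [hG, hH, Function.comp_apply, indicator, mem_preimage]
  by_cases h1 : ω ∈ pagesEvent τ t k
  · have h1' : (fun i => τ i ω) ∈ pagesEvent (fun i (v : ℕ → ℝ) => v i) t k := h1
    by_cases h2 : J (k + 1) ω = j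
    · rw [if_pos ⟨h1, h2⟩, if_pos h1', if_pos (show J (k + 1) ω ∈ ({j} : Set ℕ) from h2)]
      simp only [Pi.one_apply, mul_one]
      rfl
    · rw [if_neg fun hc => h2 hc.2, if_neg (show J (k + 1) ω ∉ ({j} : Set ℕ) from h2), mul_zero]
  · have h1' : (fun i => τ i ω) ∉ pagesEvent (fun i (v : ℕ → ℝ) => v i) t k := h1
    rw [if_neg fun hc => h1 hc.1, if_neg h1', mul_zero, zero_mul]

/-- Summing over the chosen index `j` rebuilds `pageSum`, and `1 / (k + 1)` cancels. The
decomposition holds only almost surely (nonnegative times, choice within range), hence null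
measurability. -/
theorem IsGeneralizedYuleModel.measure_newPages_eq_succ_chosenSize
    (h : IsGeneralizedYuleModel β ν lam P τ N J) (hβ : 0 < β) (ht : 0 < t) {n : ℕ} {p : ℝ → ℝ}
    (hp : ∀ j, stateProb P (N j) n = p) (hpc : Continuous p) (k : ℕ) :
    NullMeasurableSet {ω | newPages τ t ω = k + 1 ∧ chosenSize τ N J t ω = n} P ∧
    P {ω | newPages τ t ω = k + 1 ∧ chosenSize τ N J t ω = n} =
      ENNReal.ofReal (Real.exp (-(β * t)) * (1 - Real.exp (-(β * t))) ^ k *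
        ∫ s in (0 : ℝ)..t, β * Real.exp (-(β * s)) * p s) := by
  have hp0 : ∀ s, 0 ≤ p s := fun s => by rw [← hp 0]; exact measureReal_nonneg
  have hae : (⋃ j ∈ Finset.Icc 1 (k + 1), choiceEvent τ N J t n k j) =ᵐ[P]
      {ω | newPages τ t ω = k + 1 ∧ chosenSize τ N J t ω = n} := by
    filter_upwards [h.ae_newPages_eq_iff (t := t), h.ae_choice_mem] with ω h1 h2
    refine propext ?_
    change ω ∈ (⋃ j ∈ Finset.Icc 1 (k + 1), choiceEvent τ N J t n k j) ↔
      newPages τ t ω = k + 1 ∧ chosenSize τ N J t ω = n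
    simp only [mem_iUnion, choiceEvent, exists_prop]
    constructor
    · rintro ⟨j, _, ⟨hk, rfl⟩, hN⟩
      have := (h1 k).2 hk
      exact ⟨this, by rw [chosenSize, this]; exact hN⟩
    · rintro ⟨hk, hN⟩
      refine ⟨J (k + 1) ω, h2 k, ⟨(h1 k).1 hk, rfl⟩, ?_⟩
      rw [chosenSize, hk] at hN
      exact hN
  have hm : ∀ j ∈ Finset.Icc 1 (k + 1), MeasurableSet (choiceEvent τ N J t n k j) := fun j hj =>
    (h.measure_choiceEvent hp hpc hj).1
  have hdisj : (Finset.Icc 1 (k + 1) : Set ℕ).PairwiseDisjoint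
      fun j => choiceEvent τ N J t n k j := fun i _ j _ hij =>
    Set.disjoint_left.2 fun ω hi hj => hij (hi.1.2.symm.trans hj.1.2)
  refine ⟨(Finset.measurableSet_biUnion _ hm).nullMeasurableSet.congr hae, ?_⟩
  rw [← measure_congr hae, measure_biUnion_finset hdisj hm,
    Finset.sum_congr rfl fun j hj => (h.measure_choiceEvent hp hpc hj).2, ← Finset.mul_sum,
    ← lintegral_finsetSum]
  · simp_rw [← Finset.sum_mul]
    have key := lintegral_pageSum_mul_indicator hβ h.measurable_time h.law_time h.indep_time
      ht.le hpc hp0 k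
    simp only [pageSum] at key
    rw [key, ← ENNReal.ofReal_mul (by positivity)]
    congr 1
    field_simp
  · intro j _
    exact (hpc.measurable.comp (measurable_const.sub
      (measurable_creationTime h.measurable_time j))).ennreal_ofReal.mul
      (measurable_one.indicator (measurableSet_pagesEvent h.measurable_time t k))

theorem IsGeneralizedYuleModel.measure_newPages_chosenSize
    (h : IsGeneralizedYuleModel β ν lam P τ N J) (hβ : 0 < β) (ht : 0 < t) {n : ℕ} {p : ℝ → ℝ}
    (hp : ∀ j, stateProb P (N j) n = p) (hpc : Continuous p) :
    P {ω | 1 ≤ newPages τ t ω ∧ chosenSize τ N J t ω = n} =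
      ENNReal.ofReal (∫ s in (0 : ℝ)..t, β * Real.exp (-(β * s)) * p s) := by
  have hp0 : ∀ s, 0 ≤ p s := fun s => by rw [← hp 0]; exact measureReal_nonneg
  have hI : 0 ≤ ∫ s in (0 : ℝ)..t, β * Real.exp (-(β * s)) * p s :=
    intervalIntegral.integral_nonneg ht.le fun s _ => mul_nonneg (by positivity) (hp0 s)
  have hset : {ω | 1 ≤ newPages τ t ω ∧ chosenSize τ N J t ω = n} =
      ⋃ k, {ω | newPages τ t ω = k + 1 ∧ chosenSize τ N J t ω = n} := by
    ext ω
    simp only [mem_iUnion]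
    constructor
    · rintro ⟨h1, h2⟩
      exact ⟨newPages τ t ω - 1, (Nat.sub_add_cancel h1).symm, h2⟩
    · rintro ⟨k, h1, h2⟩
      exact ⟨by omega, h2⟩
  have hx : Real.exp (-(β * t)) ≤ 1 := Real.exp_le_one_iff.2 (neg_nonpos.2 (by positivity))
  rw [hset, measure_iUnion₀,
    ← (hasSum_geometric_exp hβ ht (∫ s in (0 : ℝ)..t, β * Real.exp (-(β * s)) * p s)).tsum_eq,
    ENNReal.ofReal_tsum_of_nonneg _ (hasSum_geometric_exp hβ ht _).summable]
  · exact tsum_congr fun k => (h.measure_newPages_eq_succ_chosenSize hβ ht hp hpc k).2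
  · exact fun k => mul_nonneg (mul_nonneg (Real.exp_nonneg _) (pow_nonneg (by linarith) _)) hI
  · exact fun i j hij => (Set.disjoint_left.2 fun ω hi hj =>
      hij (Nat.succ_injective (hi.1.symm.trans hj.1))).aedisjoint
  · exact fun k => (h.measure_newPages_eq_succ_chosenSize hβ ht hp hpc k).1

theorem integral_exp_density (β t : ℝ) :
    ∫ s in (0 : ℝ)..t, β * Real.exp (-(β * s)) * 1 = 1 - Real.exp (-(β * t)) := by
  have hd : ∀ s ∈ uIcc 0 t, HasDerivAt (fun s => -Real.exp (-(β * s)))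
      (β * Real.exp (-(β * s)) * 1) s := fun s _ => by
    rw [mul_one]
    exact hasDerivAt_neg_exp_mul_exp
  rw [intervalIntegral.integral_eq_sub_of_hasDerivAt hd
    (Continuous.intervalIntegrable (by fun_prop) _ _)]
  simp
  ring

theorem IsGeneralizedYuleModel.measure_newPages
    (h : IsGeneralizedYuleModel β ν lam P τ N J) (hβ : 0 < β) (ht : 0 < t) :
    NullMeasurableSet {ω | 1 ≤ newPages τ t ω} P ∧
    P {ω | 1 ≤ newPages τ t ω} = ENNReal.ofReal (1 - Real.exp (-(β * t))) := by
  have hx : Real.exp (-(β * t)) ≤ 1 := Real.exp_le_one_iff.2 (neg_nonpos.2 (by positivity))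
  have hset : {ω | 1 ≤ newPages τ t ω} = ⋃ k, {ω | newPages τ t ω = k + 1} := by
    ext ω
    simp only [mem_iUnion]
    exact ⟨fun h1 => ⟨newPages τ t ω - 1, (Nat.sub_add_cancel h1).symm⟩,
      fun ⟨k, h1⟩ => show 1 ≤ newPages τ t ω by rw [show newPages τ t ω = k + 1 from h1]; omega⟩
  have hae : ∀ k, pagesEvent τ t k =ᵐ[P] {ω | newPages τ t ω = k + 1} := fun k => by
    filter_upwards [h.ae_newPages_eq_iff (t := t)] with ω h1
    exact propext (h1 k).symm
  have hnull : ∀ k, NullMeasurableSet {ω | newPages τ t ω = k + 1} P := fun k =>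
    (measurableSet_pagesEvent h.measurable_time t k).nullMeasurableSet.congr (hae k)
  have hval : ∀ k : ℕ, P {ω | newPages τ t ω = k + 1} =
      ENNReal.ofReal (Real.exp (-(β * t)) * (1 - Real.exp (-(β * t))) ^ k *
        (1 - Real.exp (-(β * t)))) := fun k => by
    -- With `g = 1` the page sum is the constant `k + 1`, so the formula yields the probability of
    -- `k + 1` new pages.
    have key := lintegral_pageSum_mul_indicator hβ h.measurable_time h.law_time h.indep_time
      ht.le (g := fun _ => 1) continuous_const (fun _ => zero_le_one) k
    rw [integral_exp_density, ENNReal.ofReal_mul (by positivity)] at key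
    have hps : ∀ ω, pageSum τ (fun _ => (1 : ℝ)) k ω = ENNReal.ofReal ((k : ℝ) + 1) := fun ω => by
      simp only [pageSum, ENNReal.ofReal_one, Finset.sum_const, Nat.card_Icc, Nat.add_sub_cancel,
        nsmul_eq_mul, mul_one]
      rw [← Nat.cast_succ, ENNReal.ofReal_natCast]
    simp_rw [hps] at key
    rw [lintegral_const_mul _ (measurable_one.indicator
      (measurableSet_pagesEvent h.measurable_time t k)),
      ENNReal.mul_right_inj (ENNReal.ofReal_pos.2 (by positivity)).ne' ENNReal.ofReal_ne_top] at key
    rw [← key, ← measure_congr (hae k),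
      ← lintegral_indicator_one (measurableSet_pagesEvent h.measurable_time t k)]
  rw [hset]
  refine ⟨NullMeasurableSet.iUnion hnull, ?_⟩
  rw [measure_iUnion₀ _ hnull,
    ← (hasSum_geometric_exp hβ ht (1 - Real.exp (-(β * t)))).tsum_eq,
    ENNReal.ofReal_tsum_of_nonneg _ (hasSum_geometric_exp hβ ht _).summable]
  · exact tsum_congr hval
  · exact fun k => mul_nonneg (mul_nonneg (Real.exp_nonneg _) (pow_nonneg (by linarith) _))
      (by linarith)
  · exact fun i j hij => (Set.disjoint_left.2 fun ω hi hj =>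
      hij (Nat.succ_injective ((show newPages τ t ω = i + 1 from hi).symm.trans hj))).aedisjoint

theorem IsGeneralizedYuleModel.sizeProb_eq (h : IsGeneralizedYuleModel β ν lam P τ N J)
    (hβ : 0 < β) (hν : 0 < ν) (hν1 : ν ≤ 1) (ht : 0 < t) (hdist : Set.InjOn lam (Set.Ici 1))
    {n : ℕ} (hn : 1 ≤ n) :
    sizeProb P τ N J t n = 1 / (1 - Real.exp (-(β * t))) *
      ∫ s in (0 : ℝ)..t, β * Real.exp (-(β * s)) * birthSolution ν lam n s := by
  have hp : ∀ j, stateProb P (N j) n = stateProb P (N 0) n := fun j => by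
    ext s
    rw [stateProb_eq_max, stateProb_eq_max (N 0),
      (h.birth j).stateProb_eq hν hν1 hdist hn _ (le_max_right _ _),
      (h.birth 0).stateProb_eq hν hν1 hdist hn _ (le_max_right _ _)]
  have hpc := (h.birth 0).continuous_stateProb hn
  have hI : ∫ s in (0 : ℝ)..t, β * Real.exp (-(β * s)) * birthSolution ν lam n s =
      ∫ s in (0 : ℝ)..t, β * Real.exp (-(β * s)) * stateProb P (N 0) n s := by
    refine intervalIntegral.integral_congr fun s hs => ?_
    rw [uIcc_of_le ht.le] at hs
    rw [(h.birth 0).stateProb_eq hν hν1 hdist hn s hs.1]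
  have hI0 : 0 ≤ ∫ s in (0 : ℝ)..t, β * Real.exp (-(β * s)) * stateProb P (N 0) n s :=
    intervalIntegral.integral_nonneg ht.le fun s _ => mul_nonneg (by positivity)
      measureReal_nonneg
  have hx : Real.exp (-(β * t)) ≤ 1 := Real.exp_le_one_iff.2 (neg_nonpos.2 (by positivity))
  obtain ⟨hnull, hval⟩ := h.measure_newPages hβ ht
  have hnum := h.measure_newPages_chosenSize hβ ht hp hpc
  -- Null measurability of the conditioning event suffices here; none is asked of the size event.
  rw [sizeProb, ProbabilityTheory.cond, measureReal_def, Measure.smul_apply,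
    Measure.restrict_apply₀' hnull, inter_comm, hval, hI]
  rw [show {ω | 1 ≤ newPages τ t ω} ∩ {ω | chosenSize τ N J t ω = n} =
    {ω | 1 ≤ newPages τ t ω ∧ chosenSize τ N J t ω = n} from rfl, hnum, smul_eq_mul,
    ENNReal.toReal_mul, ENNReal.toReal_inv, ENNReal.toReal_ofReal (by linarith),
    ENNReal.toReal_ofReal hI0, one_div]

end Model

/-! ### Analytic continuation and the three formulas -/

/-- The sum of the power series with coefficients `Γ(ν r + 1, x) / Γ(ν r + 1)`, continued
analytically to `ℂ ∖ {1}`. -/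
noncomputable def upperGammaContinuation (ν x : ℝ) (z : ℂ) : ℂ :=
  (1 - z)⁻¹ - ∑' r : ℕ,
    ((lowerGamma (ν * r + 1) x / Real.Gamma (ν * r + 1) : ℝ) : ℂ) * z ^ r

/-- The lower gamma series is entire, so the only singularity is that of the geometric sum. -/
theorem differentiableOn_upperGammaContinuation {ν x : ℝ} (hν : 0 < ν) (hx : 0 ≤ x) :
    DifferentiableOn ℂ (upperGammaContinuation ν x) {1}ᶜ := by
  refine DifferentiableOn.sub ?_
    (differentiable_tsum_mul_pow (summable_lowerGamma_div_Gamma hν hx)).differentiableOn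
  refine DifferentiableOn.inv (by fun_prop) fun z hz => ?_
  exact sub_ne_zero.2 fun h => hz h.symm

theorem hasSum_upperGammaContinuation {ν x : ℝ} (hν : 0 < ν) (hx : 0 ≤ x) {z : ℂ}
    (hz : ‖z‖ < 1) :
    HasSum (fun r : ℕ =>
      ((upperGamma (ν * r + 1) x / Real.Gamma (ν * r + 1) : ℝ) : ℂ) * z ^ r)
      (upperGammaContinuation ν x z) := by
  have hl : Summable fun r : ℕ =>
      ((lowerGamma (ν * r + 1) x / Real.Gamma (ν * r + 1) : ℝ) : ℂ) * z ^ r := by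
    refine (summable_lowerGamma_div_Gamma hν hx ‖z‖).norm.of_norm_bounded fun r => ?_
    rw [norm_mul, norm_mul, norm_pow, norm_pow, Complex.norm_real, norm_norm]
  refine ((hasSum_geometric_of_norm_lt_one hz).sub hl.hasSum).congr_fun fun r => ?_
  rw [lowerGamma_div_Gamma hν hx]
  push_cast
  ring

theorem mainTheorem3 {Ω : Type*} [MeasurableSpace Ω] (P : Measure Ω) [IsProbabilityMeasure P]
    (β ν t : ℝ) (hβ : 0 < β) (hν : 0 < ν) (hν1 : ν ≤ 1) (ht : 0 < t)
    (lam : ℕ → ℝ) (hlam : ∀ k, 1 ≤ k → 0 ≤ lam k) (hdist : Set.InjOn lam (Set.Ici 1))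
    (τ : ℕ → Ω → ℝ) (N : ℕ → ℝ≥0 → Ω → ℕ) (J : ℕ → Ω → ℕ)
    (hmodel : IsGeneralizedYuleModel β ν lam P τ N J) :
    -- the explicit distribution, with lower incomplete gamma functions
    (∀ n : ℕ, 1 ≤ n →
      (∀ m ∈ Finset.Icc 1 n, Summable fun r : ℕ =>
        lowerGamma (ν * r + 1) (β * t) / Real.Gamma (ν * r + 1) * (-(lam m) / β ^ ν) ^ r) ∧
      sizeProb P τ N J t n =
        1 / (1 - Real.exp (-(β * t))) * (∏ h ∈ Finset.Icc 1 (n - 1), lam h) *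
          ∑ m ∈ Finset.Icc 1 n, 1 / (∏ l ∈ (Finset.Icc 1 n).erase m, (lam l - lam m)) *
            ∑' r : ℕ, lowerGamma (ν * r + 1) (β * t) / Real.Gamma (ν * r + 1) *
              (-(lam m) / β ^ ν) ^ r) ∧
    -- the form with upper incomplete gamma functions, where its series converge
    (∀ n : ℕ, 1 ≤ n → (∀ m ∈ Finset.Icc 1 n, lam m < β ^ ν) →
      (∀ m ∈ Finset.Icc 1 n, Summable fun r : ℕ =>
        upperGamma (ν * r + 1) (β * t) / Real.Gamma (ν * r + 1) * (-(lam m) / β ^ ν) ^ r) ∧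
      sizeProb P τ N J t n =
        1 / (1 - Real.exp (-(β * t))) * (∏ h ∈ Finset.Icc 1 (n - 1), lam h) *
          ∑ m ∈ Finset.Icc 1 n, 1 / (∏ l ∈ (Finset.Icc 1 n).erase m, (lam l - lam m)) *
            (β ^ ν / (β ^ ν + lam m) -
              ∑' r : ℕ, upperGamma (ν * r + 1) (β * t) / Real.Gamma (ν * r + 1) *
                (-(lam m) / β ^ ν) ^ r)) ∧
    -- the same form for all rates, with the power series continued analytically to `ℂ ∖ {1}`
    (∃ G : ℂ → ℂ, DifferentiableOn ℂ G {1}ᶜ ∧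
      (∀ z : ℂ, ‖z‖ < 1 → HasSum (fun r : ℕ =>
        ((upperGamma (ν * r + 1) (β * t) / Real.Gamma (ν * r + 1) : ℝ) : ℂ) * z ^ r) (G z)) ∧
      ∀ n : ℕ, 1 ≤ n →
        (sizeProb P τ N J t n : ℂ) =
          ((1 / (1 - Real.exp (-(β * t))) * (∏ h ∈ Finset.Icc 1 (n - 1), lam h) : ℝ) : ℂ) *
            ∑ m ∈ Finset.Icc 1 n,
              ((1 / (∏ l ∈ (Finset.Icc 1 n).erase m, (lam l - lam m)) : ℝ) : ℂ) *
                (((β ^ ν / (β ^ ν + lam m) : ℝ) : ℂ) -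
                  G ((-(lam m) / β ^ ν : ℝ) : ℂ))) := by
  have hx : 0 ≤ β * t := (mul_pos hβ ht).le
  have hβν : 0 < β ^ ν := Real.rpow_pos_of_pos hβ ν
  have hsize : ∀ n : ℕ, 1 ≤ n → sizeProb P τ N J t n =
      1 / (1 - Real.exp (-(β * t))) * (∏ h ∈ Finset.Icc 1 (n - 1), lam h) *
        ∑ m ∈ Finset.Icc 1 n, 1 / (∏ l ∈ (Finset.Icc 1 n).erase m, (lam l - lam m)) *
          ∑' r : ℕ, lowerGamma (ν * r + 1) (β * t) / Real.Gamma (ν * r + 1) *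
            (-(lam m) / β ^ ν) ^ r := fun n hn => by
    rw [hmodel.sizeProb_eq hβ hν hν1 ht hdist hn, integral_exp_mul_birthSolution hβ hν ht.le,
      ← mul_assoc]
    rfl
  have hgeo : ∀ m, 1 ≤ m → (1 - -(lam m) / β ^ ν)⁻¹ = β ^ ν / (β ^ ν + lam m) := fun m hm => by
    have := hlam m hm
    have h1 : β ^ ν + lam m ≠ 0 := by positivity
    rw [show 1 - -(lam m) / β ^ ν = (β ^ ν + lam m) / β ^ ν by field_simp; ring, inv_div]
  refine ⟨fun n hn => ⟨fun m _ => summable_lowerGamma_div_Gamma hν hx _, hsize n hn⟩,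
    fun n hn hlt => ?_, upperGammaContinuation ν (β * t),
    differentiableOn_upperGammaContinuation hν hx,
    fun z hz => hasSum_upperGammaContinuation hν hx hz, fun n hn => ?_⟩
  · have habs : ∀ m ∈ Finset.Icc 1 n, |-(lam m) / β ^ ν| < 1 := fun m hm => by
      rw [abs_div, abs_neg, abs_of_nonneg (hlam m (Finset.mem_Icc.1 hm).1), abs_of_pos hβν,
        div_lt_one hβν]
      exact hlt m hm
    refine ⟨fun m hm => summable_upperGamma_div_Gamma hν hx (habs m hm), ?_⟩
    rw [hsize n hn]
    congr 1
    refine Finset.sum_congr rfl fun m hm => ?_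
    rw [tsum_lowerGamma_eq_sub hν hx (habs m hm), hgeo m (Finset.mem_Icc.1 hm).1]
  -- At `z = -λ_m / β^ν` the term `(1 - z)⁻¹` in the continuation equals `β^ν / (β^ν + λ_m)`, so the
  -- bracket is again the lower gamma series, which converges for all rates.
  · rw [hsize n hn, Complex.ofReal_mul, Complex.ofReal_sum]
    congr 1
    refine Finset.sum_congr rfl fun m hm => ?_
    rw [Complex.ofReal_mul, upperGammaContinuation, ← hgeo m (Finset.mem_Icc.1 hm).1,
      Complex.ofReal_tsum]
    push_cast
    ring
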